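/- Let $M$ be a complete hyperbolic $3$-manifold of finite volume with at least one cusp, and let $G=\pi_1(M)$ act on $\mathbb H^3$ by deck transformations. Let $P\subseteq S^2=\partial\mathbb H^3$ be the set of parabolic points of $G$ (the points fixed by a parabolic element of $G$), and let $\{H_p\}_{p\in P}$ be a $G$-equivariant family of pairwise disjoint open horoballs in $\mathbb H^3$, with $H_p$ based at $p$. Let $x_0$ be the centre of the Poincaré ball model, identify $\partial\mathbb H^3$ with the unit sphere $S^2\subset\mathbb R^3$ of that model, equipped with the metric restricted from $\mathbb R^3$, and let $B(x,\rho)$ denote the open ball in $S^2$. For $p\in P$ put $r_p=e^{-d_{\mathbb H^3}(x_0,H_p)}$, and for $0<\lambda\le 1$ put $V_\lambda=S^2\setminus\bigcup_{p\in P}B(p,\lambda r_p)$. A Sierpiński curve in $S^2$ is a set of the form $S=S^2\setminus\bigcup_{i\in\mathbb N}D_i$, where each $D_i$ is the interior of a closed topological disk in $S^2$, the closures $\overline{D_i}$ are pairwise disjoint, $\operatorname{diam}(D_i)\to 0$, and $\bigcup_i\overline{D_i}$ is dense in $S^2$; its peripheral circles are the boundaries of the $D_i$. Then there is $\lambda_0\in(0,1]$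 such that for every $0<\lambda\le\lambda_0$ the following hold. 1. For each $p\in P$ there is a topological circle $\gamma$ such that (a) $\gamma$ is contained in $A=B(p,3\lambda r_p/4)\setminus B(p,\lambda r_p/4)$ and is homotopically non-trivial in $A$; (b) $\gamma\cap B(p',3\lambda r_{p'}/4)=\emptyset$ for each $p'\in P\setminus\{p\}$ with $r_{p'}\le r_p$. 2. There is a Sierpiński curve $S\subseteq S^2$ with $V_\lambda\subseteq S\subseteq V_{\lambda/4}$, each of whose peripheral circles is contained in $B(p,3\lambda r_p/4)$ for some $p\in P$. -/

import Mathlib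

open Metric Set Topology Filter MeasureTheory

noncomputable section

namespace CuspedHyperbolic

/-! Hyperbolic 3-space in the hyperboloid model, its isometries, volume and boundary sphere. -/

/-- Euclidean 3-space. -/
abbrev E3 : Type := EuclideanSpace ℝ (Fin 3)

/-- Minkowski space, written as time times space. -/
abbrev Mink : Type := ℝ × E3

/-- The Lorentz form of signature (3,1). -/
def lorentz (x y : Mink) : ℝ := inner ℝ x.2 y.2 - x.1 * y.1

/-- Hyperbolic 3-space: the upper sheet of the hyperboloid. -/
def H3 : Set Mink := {x | lorentz x x = -1 ∧ 0 < x.1}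

/-- The hyperbolic distance between two points of `H3`. -/
def hdist (x y : Mink) : ℝ := Real.arcosh (-lorentz x y)

/-- The base point; it is the centre of the Poincare ball model. -/
def basePoint : Mink := (1, 0)

/-- The group of isometries of `H3`: the linear automorphisms of Minkowski space that preserve
the Lorentz form and the upper sheet. -/
def isomH3 : Subgroup (Mink ≃ₗ[ℝ] Mink) where
  carrier := {g | (∀ x y, lorentz (g x) (g y) = lorentz x y) ∧ (fun x => g x) '' H3 = H3}
  one_mem' := by simp
  mul_mem' := by
    rintro a b ⟨ha, ha'⟩ ⟨hb, hb'⟩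
    refine ⟨fun x y => by simp [ha, hb], ?_⟩
    have h : (fun x => (a * b) x) = (fun x => a x) ∘ (fun x => b x) := rfl
    rw [h, image_comp, hb', ha']
  inv_mem' := by
    rintro a ⟨ha, ha'⟩
    have e : ∀ x, a (a⁻¹ x) = x := fun x => a.apply_symm_apply x
    have e' : ∀ x, a⁻¹ (a x) = x := fun x => a.symm_apply_apply x
    refine ⟨fun x y => by rw [← ha, e, e], ?_⟩
    conv_lhs => rw [← ha', image_image]
    simp [e']

/-- The Riemannian volume of `H3`, as a measure on Minkowski space carried by `H3`: in the
coordinate `v ∈ ℝ³`, the point being `(√(1 + |v|²), v)`, it is `dv / √(1 + |v|²)`. -/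
def hypVolume : Measure Mink :=
  ((volume : Measure E3).withDensity
    (fun v => ENNReal.ofReal (1 / Real.sqrt (1 + ‖v‖ ^ 2)))).map
    (fun v => ((Real.sqrt (1 + ‖v‖ ^ 2), v) : Mink))

/-- The boundary at infinity: the unit sphere of Euclidean 3-space, with the chordal metric. -/
abbrev S2 : Type := sphere (0 : E3) 1

/-- The light-like vector that spans the null ray belonging to a boundary point. -/
def nullVec (p : S2) : Mink := (1, (p : E3))

/-- The extension of the isometry `g` to the boundary sends `p` to `q`. -/
def BoundaryMaps (g : Mink ≃ₗ[ℝ] Mink) (p q : S2) : Prop :=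
  ∃ c : ℝ, 0 < c ∧ g (nullVec p) = c • nullVec q

/-- A parabolic isometry: it has no fixed point in `H3` and exactly one on the boundary. -/
def IsParabolicIsom (g : Mink ≃ₗ[ℝ] Mink) : Prop :=
  g ∈ isomH3 ∧ (∀ x ∈ H3, g x ≠ x) ∧ ∃! p : S2, BoundaryMaps g p p

/-- The parabolic points of `G`: the boundary points fixed by a parabolic element of `G`. -/
def parabolicPoints (G : Subgroup (Mink ≃ₗ[ℝ] Mink)) : Set S2 :=
  {p | ∃ g ∈ G, IsParabolicIsom g ∧ BoundaryMaps g p p}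

/-- `G` is the fundamental group, acting by deck transformations on `H3`, of a complete
hyperbolic 3-manifold `H3 / G` of finite volume with at least one cusp. -/
structure IsCuspedFiniteVolumeGroup (G : Subgroup (Mink ≃ₗ[ℝ] Mink)) : Prop where
  isometric : G ≤ isomH3
  free : ∀ g ∈ G, ∀ x ∈ H3, g x = x → g = 1
  properlyDiscontinuous : ∀ K : Set Mink, K ⊆ H3 → IsCompact K →
    {g : Mink ≃ₗ[ℝ] Mink | g ∈ G ∧ ((fun x => g x) '' K ∩ K).Nonempty}.Finite
  finiteVolume : ∃ F : Set Mink, IsFundamentalDomain G F hypVolume ∧ hypVolume F < ⊤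
  cusped : (parabolicPoints G).Nonempty

/-- The open horoballs based at `p` are the sets `{x ∈ H3 | -⟨x, nullVec p⟩ < t}`, `t > 0`:
the sublevel sets of the Busemann function `x ↦ log (-⟨x, nullVec p⟩)`. -/
def IsHoroballAt (p : S2) (B : Set Mink) : Prop :=
  ∃ t : ℝ, 0 < t ∧ B = {x | x ∈ H3 ∧ -lorentz x (nullVec p) < t}

/-- A `G`-equivariant family of pairwise disjoint horoballs, one at each parabolic point. -/
structure IsHoroballFamily (G : Subgroup (Mink ≃ₗ[ℝ] Mink))
    (H : parabolicPoints G → Set Mink) : Prop where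
  horoball : ∀ p : parabolicPoints G, IsHoroballAt (p : S2) (H p)
  disjoint : ∀ p q : parabolicPoints G, p ≠ q → Disjoint (H p) (H q)
  equivariant : ∀ g ∈ G, ∀ p q : parabolicPoints G,
    BoundaryMaps g (p : S2) (q : S2) → (fun x => g x) '' H p = H q

/-- The number `r = exp (-d(x₀, B))`, where `x₀` is the base point. -/
def radius (B : Set Mink) : ℝ := Real.exp (-sInf (hdist basePoint '' B))

/-- The stratum `V_l`, the complement of the open balls of radius `l * r_p` about the
parabolic points `p`. -/
def stratum {G : Subgroup (Mink ≃ₗ[ℝ] Mink)} (H : parabolicPoints G → Set Mink) (l : ℝ) :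
    Set S2 :=
  (⋃ p : parabolicPoints G, ball (p : S2) (l * radius (H p)))ᶜ

/-! Circles and Sierpinski curves in the sphere. -/

/-- `γ` is a topological circle contained in `A` and homotopically non-trivial in `A`. -/
def IsEssentialCircle (A γ : Set S2) : Prop :=
  ∃ c : C(Circle, A), IsEmbedding c ∧ ¬ c.Nullhomotopic ∧ γ = range (fun z => (c z : S2))

/-- The closed unit disk. -/
abbrev Disk : Type := closedBall (0 : EuclideanSpace ℝ (Fin 2)) 1

/-- The interior of the closed disk parametrized by `e`. -/
def diskInterior (e : C(Disk, S2)) : Set S2 :=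
  (fun x => e x) '' {x | ‖(x : EuclideanSpace ℝ (Fin 2))‖ < 1}

/-- The boundary circle of the closed disk parametrized by `e`. -/
def diskBoundary (e : C(Disk, S2)) : Set S2 :=
  (fun x => e x) '' {x | ‖(x : EuclideanSpace ℝ (Fin 2))‖ = 1}

/-- `S` is a Sierpinski curve in the sphere and `C` is the set of its peripheral circles: `S` is
the complement of the union of the interiors `D i` of closed disks whose closures are pairwise
disjoint, whose diameters tend to `0`, and the union of whose closures is dense; `C` consists of
the boundaries of the `D i`. -/
def IsSierpinskiCurve (S : Set S2) (C : Set (Set S2)) : Prop :=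
  ∃ e : ℕ → C(Disk, S2),
    (∀ i, IsEmbedding (e i)) ∧
    (∀ i j, i ≠ j → Disjoint (closure (diskInterior (e i))) (closure (diskInterior (e j)))) ∧
    Tendsto (fun i => diam (diskInterior (e i))) atTop (𝓝 0) ∧
    Dense (⋃ i, closure (diskInterior (e i))) ∧
    S = (⋃ i, diskInterior (e i))ᶜ ∧
    C = range (fun i => diskBoundary (e i))

end CuspedHyperbolic

end

open CuspedHyperbolic

/-!
The horoballs enter only through an inequality. If the horoballs at `p` and `q` are disjoint, then
`|p - q| ≥ 2 √(r_p r_q)` for the chordal distance (`IsThreshold.sep`), and `r_p ≤ 1`. Together with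
the density of the parabolic points this is `IsSeparatedFamily`, and both parts of the theorem hold
for every separated family of points of the sphere as soon as `l ≤ 1 / 1000`.

*The circles.* If `p' ≠ p` is at distance less than `2 l r_p` from `p`, the inequality gives
`r_{p'} ≤ l² r_p`; and the balls of radius `l r_{p'}` around these `p'` are sparse: the distance of
two centres is at least `2 / l` times the geometric mean of the two radii. In stereographic
coordinates centred at `p`, consider the round circle of radius `l r_p / 2`. A homeomorphism of the
plane close to the identity moves it off all these balls (`IsSparse.exists_homeomorph`): treat the
balls in the order of decreasing radius, and at each step push the current image of the circle off
the ball of radius `2 ρ` by a homeomorphism that is supported in the ball of radius `7 ρ` and whose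
inverse is Lipschitz with constant `3` (`exists_homeomorph_push_off`). The compositions converge
uniformly. Because of the sparseness, later steps hardly disturb what earlier ones achieved, and
the limit is injective (`IsPushSequence.injective_lim`): a step shrinks distances at most by a
factor `3`, whereas between two steps that move one of two points with the same limit the radius of
the ball shrinks at least by a factor `50`. The image of the circle is therefore a Jordan curve that
bounds a disk, the image of the round one; it stays close to the round circle, so that a continuous
logarithm along a null-homotopy would give one of the inclusion of the unit circle
(`not_nullhomotopic_of_norm_sub_lt`). See `IsSeparatedFamily.exists_isGoodDisk`.

*The Sierpinski curve.* The boundary of the disk at `p` avoids the ball of radius `3 l r_{p'} / 4`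
around `p'` if `r_{p'} ≤ r_p`, and this ball is connected and contains the disk at `p'`. So any two
of the disks are disjoint or nested (`IsGoodDisk.subset_or_disjoint`). Every disk lies in a maximal
one, as only finitely many weights exceed a given number, and the curve is the complement of the
interiors of the maximal disks (`IsSeparatedFamily.exists_isSierpinskiCurve`). There are infinitely
many of these: finitely many disjoint closed disks with dense union would disconnect the sphere.

*Density.* This is where the finite volume is used (`IsHoroballFamily.dense_parabolicPoints`).
Suppose that no parabolic point is near `u`. The part of hyperbolic space seen from the base point
in directions near `u` has infinite volume. Let `N_p` be the null vector such that the horoball at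
`p` is given by `-⟨x, N_p⟩ < 1`; the group permutes these vectors, and a point `x` is nearest to the
horoball at `p` when `-⟨x, N_p⟩` is minimal. For `x` in the cone only finitely many `p` compete, and
the projection of `x` to the nearest horosphere lies in a compact set. This projection is
equivariant, hence by proper discontinuity the cone meets only finitely many of its translates, so
it has finite volume (`IsCuspedFiniteVolumeGroup.hypVolume_lt_top`), a contradiction. The volume is
invariant under isometries since the volume of `A` is a constant multiple of the Lebesgue measure of
the cone over `A` in the unit ball of the Lorentz form (`hypVolume_preimage`).
-/

noncomputable section

namespace CuspedHyperbolic

/-! ### Squeezing the plane radially -/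

section Squeeze

variable {E : Type*} [NormedAddCommGroup E] [InnerProductSpace ℝ E]

/-- The factor by which the squeeze map of inner radius `3 * ρ` and outer radius `6 * ρ` scales
a vector of norm `s`. -/
def squeezeFactor (a ρ s : ℝ) : ℝ := max a (min 1 ((s - 3 * ρ) / (3 * ρ)))

lemma squeezeFactor_ge (a ρ s : ℝ) : a ≤ squeezeFactor a ρ s := le_max_left _ _

lemma squeezeFactor_le_one {a : ℝ} (ha : a ≤ 1) (ρ s : ℝ) : squeezeFactor a ρ s ≤ 1 :=
  max_le ha (min_le_left _ _)

lemma squeezeFactor_mono {a ρ : ℝ} (hρ : 0 < ρ) : Monotone (squeezeFactor a ρ) := by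
  intro s t h
  unfold squeezeFactor
  gcongr

lemma squeezeFactor_of_ge {a ρ s : ℝ} (ha : a ≤ 1) (hρ : 0 < ρ) (hs : 6 * ρ ≤ s) :
    squeezeFactor a ρ s = 1 := by
  have : 1 ≤ (s - 3 * ρ) / (3 * ρ) := by rw [le_div_iff₀ (by positivity)]; linarith
  simp [squeezeFactor, this, ha]

lemma squeezeFactor_of_le {a ρ s : ℝ} (ha : 0 ≤ a) (hρ : 0 < ρ) (hs : s ≤ 3 * ρ) :
    squeezeFactor a ρ s = a := by
  have : (s - 3 * ρ) / (3 * ρ) ≤ 0 := div_nonpos_of_nonpos_of_nonneg (by linarith) (by positivity)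
  exact max_eq_left ((min_le_right _ _).trans (this.trans ha))

lemma squeezeFactor_lipschitz {a ρ s t : ℝ} (hρ : 0 < ρ) (h : s ≤ t) :
    squeezeFactor a ρ t - squeezeFactor a ρ s ≤ (t - s) / (3 * ρ) := by
  have e : (t - 3 * ρ) / (3 * ρ) = (s - 3 * ρ) / (3 * ρ) + (t - s) / (3 * ρ) := by ring
  have h0 : 0 ≤ (t - s) / (3 * ρ) := div_nonneg (by linarith) (by positivity)
  unfold squeezeFactor
  rw [e, sub_le_iff_le_add]
  refine max_le ?_ ?_
  · have := le_max_left a (min 1 ((s - 3 * ρ) / (3 * ρ)))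
    linarith
  · have h1 := le_max_right a (min 1 ((s - 3 * ρ) / (3 * ρ)))
    rcases le_total 1 ((s - 3 * ρ) / (3 * ρ)) with h2 | h2
    · rw [min_eq_left h2] at h1 ⊢
      exact (min_le_left _ _).trans (by linarith)
    · rw [min_eq_right h2] at h1 ⊢
      exact (min_le_right _ _).trans (by linarith)

/-- The radial map about the origin that scales the ball of radius `3 * ρ` by `a` and is the
identity outside the ball of radius `6 * ρ`. -/
def squeeze (a ρ : ℝ) (v : E) : E := squeezeFactor a ρ ‖v‖ • v

lemma norm_squeeze {a : ℝ} (ha : 0 ≤ a) (ρ : ℝ) (v : E) :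
    ‖squeeze a ρ v‖ = squeezeFactor a ρ ‖v‖ * ‖v‖ := by
  rw [squeeze, norm_smul, Real.norm_of_nonneg (ha.trans (squeezeFactor_ge _ _ _))]

lemma norm_squeeze_sub_le {a ρ : ℝ} (ha : 0 ≤ a) (ha1 : a ≤ 1) (hρ : 0 < ρ) (v w : E) :
    ‖squeeze a ρ v - squeeze a ρ w‖ ≤ 3 * ‖v - w‖ := by
  wlog h : ‖w‖ ≤ ‖v‖ generalizing v w
  · rw [norm_sub_rev, norm_sub_rev v]
    exact this w v (le_of_not_ge h)
  have e : squeeze a ρ v - squeeze a ρ w = squeezeFactor a ρ ‖v‖ • (v - w)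
      + (squeezeFactor a ρ ‖v‖ - squeezeFactor a ρ ‖w‖) • w := by
    simp only [squeeze]; module
  have h0 := squeezeFactor_mono (a := a) hρ h
  have h1 : (squeezeFactor a ρ ‖v‖ - squeezeFactor a ρ ‖w‖) * ‖w‖ ≤ 2 * ‖v - w‖ := by
    rcases le_total (6 * ρ) ‖w‖ with hw | hw
    · rw [squeezeFactor_of_ge ha1 hρ hw, squeezeFactor_of_ge ha1 hρ (hw.trans h)]
      simp
    · calc (squeezeFactor a ρ ‖v‖ - squeezeFactor a ρ ‖w‖) * ‖w‖
          ≤ (‖v - w‖ / (3 * ρ)) * (6 * ρ) := by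
            have := squeezeFactor_lipschitz (a := a) hρ h
            have h2 : (‖v‖ - ‖w‖) / (3 * ρ) ≤ ‖v - w‖ / (3 * ρ) := by
              gcongr; exact norm_sub_norm_le v w
            gcongr
            exact this.trans h2
        _ = 2 * ‖v - w‖ := by field_simp; ring
  have h2 : squeezeFactor a ρ ‖v‖ * ‖v - w‖ ≤ 1 * ‖v - w‖ := by
    gcongr; exact squeezeFactor_le_one ha1 _ _
  rw [e]
  refine (norm_add_le _ _).trans ?_
  rw [norm_smul, norm_smul, Real.norm_of_nonneg (ha.trans (squeezeFactor_ge _ _ _)),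
    Real.norm_of_nonneg (by linarith)]
  linarith

lemma le_norm_squeeze_sub {a ρ : ℝ} (ha : 0 ≤ a) (hρ : 0 < ρ) (v w : E) :
    a * ‖v - w‖ ≤ ‖squeeze a ρ v - squeeze a ρ w‖ := by
  wlog h : ‖w‖ ≤ ‖v‖ generalizing v w
  · rw [norm_sub_rev, norm_sub_rev (squeeze a ρ v)]
    exact this w v (le_of_not_ge h)
  have h0 := squeezeFactor_mono (a := a) hρ h
  have h1 := squeezeFactor_ge a ρ ‖w‖
  have e : squeeze a ρ v - squeeze a ρ w = squeezeFactor a ρ ‖w‖ • (v - w)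
      + (squeezeFactor a ρ ‖v‖ - squeezeFactor a ρ ‖w‖) • v := by
    simp only [squeeze]; module
  -- The second summand makes an acute angle with the first.
  have hip : 0 ≤ inner ℝ (v - w) v := by
    rw [inner_sub_left, real_inner_self_eq_norm_sq]
    have := real_inner_le_norm w v
    nlinarith [norm_nonneg v]
  have h2 : squeezeFactor a ρ ‖w‖ * ‖v - w‖ ≤ ‖squeeze a ρ v - squeeze a ρ w‖ := by
    apply le_of_sq_le_sq _ (norm_nonneg _)
    rw [e, norm_add_sq_real, norm_smul, inner_smul_left, inner_smul_right,
      Real.norm_of_nonneg (ha.trans h1)]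
    have : 0 ≤ 2 * ((starRingEnd ℝ) (squeezeFactor a ρ ‖w‖) *
        ((squeezeFactor a ρ ‖v‖ - squeezeFactor a ρ ‖w‖) * inner ℝ (v - w) v)) := by
      have := ha.trans h1
      have h3 := sub_nonneg.2 h0
      simp only [conj_trivial]
      positivity
    nlinarith [sq_nonneg ‖(squeezeFactor a ρ ‖v‖ - squeezeFactor a ρ ‖w‖) • v‖]
  refine le_trans ?_ h2
  gcongr

lemma squeeze_surjective {a : ℝ} (ha : 0 < a) (ρ : ℝ) :
    Function.Surjective (squeeze a ρ : E → E) := by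
  intro v
  have hc : ContinuousOn (fun t : ℝ => squeezeFactor a ρ (t * ‖v‖) * t) (Icc 0 (1 / a)) := by
    unfold squeezeFactor
    fun_prop
  have h1 : (1 : ℝ) ∈ (fun t : ℝ => squeezeFactor a ρ (t * ‖v‖) * t) '' Icc 0 (1 / a) := by
    refine intermediate_value_Icc (by positivity) hc ⟨by simp, ?_⟩
    have := squeezeFactor_ge a ρ (1 / a * ‖v‖)
    calc (1 : ℝ) = a * (1 / a) := by field_simp
      _ ≤ _ := by gcongr
  obtain ⟨t, ⟨ht0, -⟩, ht⟩ := h1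
  refine ⟨t • v, ?_⟩
  simp only [squeeze, norm_smul, Real.norm_of_nonneg ht0, smul_smul]
  simp only at ht
  rw [ht, one_smul]

lemma squeeze_continuous {a ρ : ℝ} (ha : 0 ≤ a) (ha1 : a ≤ 1) (hρ : 0 < ρ) :
    Continuous (squeeze a ρ : E → E) := by
  refine (LipschitzWith.of_dist_le_mul (K := 3) fun v w => ?_).continuous
  simpa [dist_eq_norm] using norm_squeeze_sub_le ha ha1 hρ v w

/-- The squeeze map as a homeomorphism. -/
def squeezeHomeomorph (E : Type*) [NormedAddCommGroup E] [InnerProductSpace ℝ E] {a ρ : ℝ}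
    (ha : 0 < a) (ha1 : a ≤ 1) (hρ : 0 < ρ) : E ≃ₜ E :=
  have hinj : Function.Injective (squeeze a ρ : E → E) := fun v w h => by
    have := le_norm_squeeze_sub ha.le hρ v w
    rw [h, sub_self, norm_zero] at this
    have h2 : ‖v - w‖ = 0 := le_antisymm (by nlinarith) (norm_nonneg _)
    exact sub_eq_zero.1 (norm_eq_zero.1 h2)
  { toEquiv := Equiv.ofBijective (squeeze a ρ) ⟨hinj, squeeze_surjective ha ρ⟩
    continuous_toFun := squeeze_continuous ha.le ha1 hρ
    continuous_invFun := by
      refine (LipschitzWith.of_dist_le_mul (K := Real.toNNReal a⁻¹) fun v w => ?_).continuous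
      set F := Equiv.ofBijective (squeeze a ρ : E → E) ⟨hinj, squeeze_surjective ha ρ⟩
      have h := le_norm_squeeze_sub ha.le hρ (F.symm v) (F.symm w)
      have e : ∀ x, squeeze a ρ (F.symm x) = x := F.apply_symm_apply
      rw [e, e] at h
      rw [dist_eq_norm, dist_eq_norm, Real.coe_toNNReal _ (inv_nonneg.2 ha.le), ← div_eq_inv_mul,
        le_div_iff₀ ha]
      simpa [mul_comm] using h }

/-- A closed set with empty interior can be pushed off the ball of radius `2 * ρ` about `c` by a
homeomorphism that is supported in the ball of radius `7 * ρ` and whose inverse is Lipschitz with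
the universal constant `3`: a small ball off the set, centred close to `c`, is blown up. -/
lemma exists_homeomorph_push_off {Z : Set E} (hZ : IsClosed Z) (hZi : interior Z = ∅) (c : E)
    {ρ : ℝ} (hρ : 0 < ρ) :
    ∃ φ : E ≃ₜ E, (∀ x, x ∉ ball c (7 * ρ) → φ x = x) ∧
      (∀ x, x ∈ ball c (7 * ρ) → φ x ∈ ball c (7 * ρ)) ∧
      (∀ x y, ‖x - y‖ ≤ 3 * ‖φ x - φ y‖) ∧ ∀ x ∈ Z, φ x ∉ ball c (2 * ρ) := by
  have hd : Dense Zᶜ := interior_eq_empty_iff_dense_compl.1 hZi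
  obtain ⟨c', hc', hc'Z⟩ := hd.exists_mem_open isOpen_ball
    ⟨c, mem_ball_self (half_pos hρ)⟩ |>.imp fun _ h => And.symm h
  rw [mem_ball, dist_eq_norm] at hc'
  obtain ⟨τ, hτ, hτZ⟩ := Metric.isOpen_iff.1 hZ.isOpen_compl c' hc'Z
  set a : ℝ := min 1 (τ / (3 * ρ)) with ha_def
  have ha : 0 < a := by positivity
  have ha1 : a ≤ 1 := min_le_left _ _
  have haτ : a * (3 * ρ) ≤ τ := by
    rw [← le_div_iff₀ (by positivity)]; exact min_le_right _ _
  let S := squeezeHomeomorph E ha ha1 hρ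
  have hSa : ∀ x, S x = squeeze a ρ x := fun _ => rfl
  have hSn : ∀ x, ‖S x‖ ≤ ‖x‖ := fun x => by
    rw [hSa, norm_squeeze ha.le]
    have := squeezeFactor_le_one ha1 ρ ‖x‖
    nlinarith [norm_nonneg x]
  have hSout : ∀ x, 6 * ρ ≤ ‖x‖ → S x = x := fun x hx => by
    rw [hSa, squeeze, squeezeFactor_of_ge ha1 hρ hx, one_smul]
  have hSymm : ∀ x, ‖x‖ < 6 * ρ → ‖S.symm x‖ < 6 * ρ := fun x hx => by
    by_contra! hcon
    have := hSout _ hcon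
    rw [S.apply_symm_apply] at this
    rw [← this] at hcon
    linarith
  have hSymmOut : ∀ x, 6 * ρ ≤ ‖x‖ → S.symm x = x := fun x hx => by
    rw [Homeomorph.symm_apply_eq, hSout x hx]
  let φ : E ≃ₜ E := ((Homeomorph.addRight (-c')).trans S.symm).trans (Homeomorph.addRight c')
  have hφ : ∀ x, φ x = S.symm (x - c') + c' := fun x => by simp [φ, sub_eq_add_neg]
  refine ⟨φ, fun x hx => ?_, fun x hx => ?_, fun x y => ?_, fun x hx hx' => ?_⟩
  · rw [mem_ball, dist_eq_norm, not_lt] at hx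
    have : 6 * ρ ≤ ‖x - c'‖ := by
      have := norm_sub_le_norm_sub_add_norm_sub x c' c
      linarith
    rw [hφ, hSymmOut _ this, sub_add_cancel]
  · by_cases h : ‖x - c'‖ < 6 * ρ
    · rw [hφ, mem_ball, dist_eq_norm]
      have h1 := hSymm _ h
      have : S.symm (x - c') + c' - c = S.symm (x - c') + (c' - c) := by abel
      rw [this]
      refine (norm_add_le _ _).trans_lt ?_
      linarith
    · rw [hφ, hSymmOut _ (not_lt.1 h), sub_add_cancel]
      exact hx
  · have := norm_squeeze_sub_le ha.le ha1 hρ (S.symm (x - c')) (S.symm (y - c'))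
    rw [← hSa, ← hSa, S.apply_symm_apply, S.apply_symm_apply] at this
    rw [hφ, hφ]
    simpa using this
  · rw [hφ, mem_ball, dist_eq_norm] at hx'
    have h1 : ‖S.symm (x - c')‖ < 3 * ρ := by
      have : S.symm (x - c') = (S.symm (x - c') + c' - c) - (c' - c) := by abel
      rw [this]
      refine (norm_sub_le _ _).trans_lt ?_
      linarith
    have h2 : ‖S (S.symm (x - c'))‖ < τ := by
      rw [hSa, norm_squeeze ha.le, squeezeFactor_of_le ha.le hρ h1.le]
      calc _ < a * (3 * ρ) := by gcongr
        _ ≤ τ := haτ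
    rw [S.apply_symm_apply] at h2
    exact hτZ (mem_ball.2 (by rwa [dist_eq_norm])) hx

end Squeeze

/-! ### Pushing a closed set off a sparse family of balls -/

section Limit

variable {E : Type*} [NormedAddCommGroup E]

/-- A sequence of balls with decreasing radii `ρ` that are sparse, in the sense that the distance
of two centres is much larger than the geometric mean of the radii. The factor `1000` is not
optimal; it leaves room for the estimates below. -/
structure IsSparse (c : ℕ → E) (ρ : ℕ → ℝ) : Prop where
  pos : ∀ i, 0 < ρ i
  anti : Antitone ρ
  tendsto : Tendsto ρ atTop (𝓝 0)
  sep : ∀ i j, i ≠ j → 1000 * Real.sqrt (ρ i * ρ j) ≤ ‖c i - c j‖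

/-- A ball that comes close to a larger ball, relative to its radius, is much smaller. -/
lemma IsSparse.radius_le {c : ℕ → E} {ρ : ℕ → ℝ} (h : IsSparse c ρ) {i n : ℕ} (hin : i < n) {x : E}
    (hi : ‖x - c i‖ ≤ 63 * ρ i) (hn : ‖x - c n‖ ≤ 63 * ρ n) : 50 * ρ n ≤ ρ i := by
  have h1 := h.sep i n hin.ne
  have h2 : ‖c i - c n‖ ≤ 126 * ρ i := by
    have := norm_sub_le_norm_sub_add_norm_sub (c i) x (c n)
    rw [norm_sub_rev (c i) x] at this
    linarith [h.anti hin.le]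
  have hp := h.pos i
  have hq := h.pos n
  have h3 : Real.sqrt (ρ i * ρ n) ≤ 126 / 1000 * ρ i := by linarith
  rw [Real.sqrt_le_left (by positivity)] at h3
  have h4 : ρ i * (50 * ρ n) ≤ ρ i * ρ i := by nlinarith
  exact le_of_mul_le_mul_left h4 hp

/-- A sequence of homeomorphisms, the `n`-th of which is supported in the ball of radius `7 * ρ n`
about `c n` and has an inverse that is Lipschitz with constant `3`. -/
structure IsPushSequence (c : ℕ → E) (ρ : ℕ → ℝ) (φ : ℕ → E ≃ₜ E) : Prop where
  eq_self : ∀ n x, x ∉ ball (c n) (7 * ρ n) → φ n x = x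
  mem_ball : ∀ n x, x ∈ ball (c n) (7 * ρ n) → φ n x ∈ ball (c n) (7 * ρ n)
  expand : ∀ n x y, ‖x - y‖ ≤ 3 * ‖φ n x - φ n y‖

/-- The composition of the first `n` homeomorphisms of a sequence. -/
def iterComp (φ : ℕ → E ≃ₜ E) : ℕ → E ≃ₜ E
  | 0 => Homeomorph.refl E
  | n + 1 => (iterComp φ n).trans (φ n)

variable {c : ℕ → E} {ρ : ℕ → ℝ} {φ : ℕ → E ≃ₜ E}

lemma iterComp_succ_apply (n : ℕ) (x : E) : iterComp φ (n + 1) x = φ n (iterComp φ n x) := rfl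

lemma IsPushSequence.iterComp_succ_of_notMem (hφ : IsPushSequence c ρ φ) {n : ℕ} {x : E}
    (h : iterComp φ n x ∉ ball (c n) (7 * ρ n)) : iterComp φ (n + 1) x = iterComp φ n x :=
  hφ.eq_self n _ h

/-- The orbit of a point moves little from step `n` on; and it moves very little if it is close to
a ball that has been dealt with before. Both bounds are proved together, by induction on the number
of steps: a step that moves the point brings it close to `c n`, after which it moves at most
`ρ n / 3`, hence altogether at most `(14 + 1 / 3) * ρ n`. -/
lemma IsPushSequence.norm_iterComp_sub_le (hφ : IsPushSequence c ρ φ) (h : IsSparse c ρ) (x : E)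
    (k : ℕ) : ∀ n, ‖iterComp φ (n + k) x - iterComp φ n x‖ ≤ 15 * ρ n ∧
      ∀ i < n, ‖iterComp φ n x - c i‖ ≤ 63 * ρ i →
        ‖iterComp φ (n + k) x - iterComp φ n x‖ ≤ ρ i / 3 := by
  induction k with
  | zero =>
    intro n
    have := h.pos n
    simp only [add_zero, sub_self, norm_zero]
    exact ⟨by linarith, fun i _ _ => by linarith [h.pos i]⟩
  | succ k ih =>
    intro n
    obtain ⟨ih1, ih2⟩ := ih (n + 1)
    rw [show n + 1 + k = n + (k + 1) by ring] at ih1 ih2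
    by_cases hx : iterComp φ n x ∈ ball (c n) (7 * ρ n)
    · have hx' := hφ.mem_ball n _ hx
      rw [← iterComp_succ_apply] at hx'
      rw [Metric.mem_ball, dist_eq_norm] at hx hx'
      have hp := h.pos n
      have h1 := ih2 n (by omega) (by linarith)
      have key : ‖iterComp φ (n + (k + 1)) x - iterComp φ n x‖ ≤ 15 * ρ n := by
        have e : iterComp φ (n + (k + 1)) x - iterComp φ n x =
            (iterComp φ (n + (k + 1)) x - iterComp φ (n + 1) x) +
            ((iterComp φ (n + 1) x - c n) - (iterComp φ n x - c n)) := by abel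
        rw [e]
        refine (norm_add_le _ _).trans ?_
        have := norm_sub_le (iterComp φ (n + 1) x - c n) (iterComp φ n x - c n)
        linarith
      refine ⟨key, fun i hi hix => key.trans ?_⟩
      have := h.radius_le hi hix (by linarith)
      linarith
    · rw [hφ.iterComp_succ_of_notMem hx] at ih1 ih2
      exact ⟨ih1.trans (by linarith [h.anti (Nat.le_succ n)]), fun i hi hix => ih2 i (by omega) hix⟩

lemma IsPushSequence.norm_iterComp_sub_iterComp_le (hφ : IsPushSequence c ρ φ) (h : IsSparse c ρ)
    (x : E) {n m : ℕ} (hnm : n ≤ m) : ‖iterComp φ m x - iterComp φ n x‖ ≤ 15 * ρ n := by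
  obtain ⟨k, rfl⟩ := Nat.exists_eq_add_of_le hnm
  exact (hφ.norm_iterComp_sub_le h x k n).1

variable [InnerProductSpace ℝ E] [FiniteDimensional ℝ E]

lemma IsPushSequence.exists_tendsto (hφ : IsPushSequence c ρ φ) (h : IsSparse c ρ) (x : E) :
    ∃ y, Tendsto (fun n => iterComp φ n x) atTop (𝓝 y) := by
  have : CompleteSpace E := FiniteDimensional.complete ℝ E
  apply cauchySeq_tendsto_of_complete
  refine cauchySeq_of_le_tendsto_0 (fun n => 30 * ρ n) (fun n m N hn hm => ?_) ?_
  · have h1 := hφ.norm_iterComp_sub_iterComp_le h x hn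
    have h2 := hφ.norm_iterComp_sub_iterComp_le h x hm
    have := dist_triangle_right (iterComp φ n x) (iterComp φ m x) (iterComp φ N x)
    rw [dist_eq_norm, dist_eq_norm, dist_eq_norm] at this
    rw [dist_eq_norm]
    linarith
  · simpa using h.tendsto.const_mul 30

/-- The limit of the compositions of a push sequence. -/
def IsPushSequence.lim (hφ : IsPushSequence c ρ φ) (h : IsSparse c ρ) (x : E) : E :=
  (hφ.exists_tendsto h x).choose

lemma IsPushSequence.tendsto_lim (hφ : IsPushSequence c ρ φ) (h : IsSparse c ρ) (x : E) :
    Tendsto (fun n => iterComp φ n x) atTop (𝓝 (hφ.lim h x)) :=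
  (hφ.exists_tendsto h x).choose_spec

lemma IsPushSequence.norm_lim_sub_le (hφ : IsPushSequence c ρ φ) (h : IsSparse c ρ) (x : E)
    (n : ℕ) : ‖hφ.lim h x - iterComp φ n x‖ ≤ 15 * ρ n := by
  refine le_of_tendsto ((hφ.tendsto_lim h x).sub_const _).norm ?_
  filter_upwards [eventually_ge_atTop n] with m hm
  exact hφ.norm_iterComp_sub_iterComp_le h x hm

lemma IsPushSequence.norm_lim_sub_le_of_close (hφ : IsPushSequence c ρ φ) (h : IsSparse c ρ) (x : E)
    {i n : ℕ} (hi : i < n) (hx : ‖iterComp φ n x - c i‖ ≤ 63 * ρ i) :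
    ‖hφ.lim h x - iterComp φ n x‖ ≤ ρ i / 3 := by
  refine le_of_tendsto ((hφ.tendsto_lim h x).sub_const _).norm ?_
  filter_upwards [eventually_ge_atTop n] with m hm
  obtain ⟨k, rfl⟩ := Nat.exists_eq_add_of_le hm
  exact (hφ.norm_iterComp_sub_le h x k n).2 i hi hx

lemma IsPushSequence.continuous_lim (hφ : IsPushSequence c ρ φ) (h : IsSparse c ρ) :
    Continuous (hφ.lim h) := by
  refine TendstoUniformly.continuous (F := fun n x => iterComp φ n x) (p := atTop) ?_
    (Frequently.of_forall fun n => (iterComp φ n).continuous)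
  rw [Metric.tendstoUniformly_iff]
  intro ε hε
  have : Tendsto (fun n => 15 * ρ n) atTop (𝓝 0) := by simpa using h.tendsto.const_mul 15
  filter_upwards [this.eventually (gt_mem_nhds hε)] with n hn x
  rw [dist_eq_norm]
  exact (hφ.norm_lim_sub_le h x n).trans_lt hn

/-- If the limit identifies two points then the ratio of the distance of their images to the radius
of the ball being dealt with at least doubles at each step that moves one of them, although it is
bounded. -/
lemma IsPushSequence.injective_lim (hφ : IsPushSequence c ρ φ) (h : IsSparse c ρ) :
    Function.Injective (hφ.lim h) := by
  intro x y hxy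
  by_contra hne
  let A : ℕ → Prop := fun n =>
    iterComp φ n x ∈ ball (c n) (7 * ρ n) ∨ iterComp φ n y ∈ ball (c n) (7 * ρ n)
  let d : ℕ → ℝ := fun n => ‖iterComp φ n x - iterComp φ n y‖
  have hd : ∀ n, 0 < d n := fun n =>
    norm_pos_iff.2 (sub_ne_zero.2 fun e => hne ((iterComp φ n).injective e))
  have hd30 : ∀ n, d n ≤ 30 * ρ n := fun n => by
    have h1 := hφ.norm_lim_sub_le h x n
    have h2 := hφ.norm_lim_sub_le h y n
    rw [← hxy] at h2
    have := norm_sub_le (hφ.lim h x - iterComp φ n y) (hφ.lim h x - iterComp φ n x)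
    have e : (hφ.lim h x - iterComp φ n y) - (hφ.lim h x - iterComp φ n x) =
      iterComp φ n x - iterComp φ n y := by abel
    rw [e] at this
    simp only [d]
    linarith
  have hstay : ∀ n k, (∀ m, n ≤ m → m < n + k → ¬ A m) →
      iterComp φ (n + k) x = iterComp φ n x ∧ iterComp φ (n + k) y = iterComp φ n y := by
    intro n k
    induction k with
    | zero => intro _; exact ⟨rfl, rfl⟩
    | succ k ih =>
      intro hk
      obtain ⟨e1, e2⟩ := ih fun m hm hm' => hk m hm (by omega)
      have hA := hk (n + k) (by omega) (by omega)
      simp only [A, not_or] at hA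
      rw [← add_assoc, hφ.iterComp_succ_of_notMem hA.1, hφ.iterComp_succ_of_notMem hA.2]
      exact ⟨e1, e2⟩
  have hnext : ∀ n, ∃ k, A (n + k) ∧ iterComp φ (n + k) x = iterComp φ n x ∧
      iterComp φ (n + k) y = iterComp φ n y := by
    intro n
    have hex : ∃ k, A (n + k) := by
      by_contra! hno
      have hall : ∀ k, d n ≤ 30 * ρ (n + k) := fun k => by
        obtain ⟨e1, e2⟩ := hstay n k fun m hm _ => by
          obtain ⟨j, rfl⟩ := Nat.exists_eq_add_of_le hm
          exact hno j
        have := hd30 (n + k)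
        simp only [d, e1, e2] at this
        exact this
      have ht : Tendsto (fun k => 30 * ρ (n + k)) atTop (𝓝 0) := by
        have := (h.tendsto.const_mul 30).comp (tendsto_add_atTop_nat n)
        simpa [Function.comp_def, add_comm] using this
      exact absurd (ge_of_tendsto' ht hall) (not_le.2 (hd n))
    classical
    refine ⟨Nat.find hex, Nat.find_spec hex, hstay n _ fun m hm hm' => ?_⟩
    obtain ⟨j, rfl⟩ := Nat.exists_eq_add_of_le hm
    exact Nat.find_min hex (by omega)
  have hgrow : ∀ k : ℕ, ∃ j, A j ∧ 2 ^ k * (d 0 / ρ 0) ≤ d j / ρ j := by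
    intro k
    induction k with
    | zero =>
      obtain ⟨k, hA, e1, e2⟩ := hnext 0
      refine ⟨0 + k, hA, ?_⟩
      have e : d (0 + k) = d 0 := by simp only [d, e1, e2]
      rw [pow_zero, one_mul, e]
      exact div_le_div_of_nonneg_left (hd 0).le (h.pos _) (h.anti (by omega))
    | succ k ih =>
      obtain ⟨j, hAj, hj⟩ := ih
      obtain ⟨k', hA, e1, e2⟩ := hnext (j + 1)
      refine ⟨j + 1 + k', hA, ?_⟩
      have e : d (j + 1 + k') = d (j + 1) := by simp only [d, e1, e2]
      have h3 : d j ≤ 3 * d (j + 1) := hφ.expand j _ _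
      have hpj := h.pos j
      have hpj' := h.pos (j + 1 + k')
      have hd1 := hd30 (j + 1)
      have hd2 := hd30 j
      have hρ1 := h.anti (Nat.le_succ j)
      -- Both points are close to the centre of the ball that moves one of them.
      have hclose : ∀ z w : E, (iterComp φ j z ∈ ball (c j) (7 * ρ j)) →
          ‖iterComp φ (j + 1) z - iterComp φ (j + 1) w‖ ≤ 30 * ρ (j + 1) →
          ‖iterComp φ (j + 1) z - c j‖ ≤ 63 * ρ j ∧ ‖iterComp φ (j + 1) w - c j‖ ≤ 63 * ρ j := by
        intro z w hz hzw
        have hz' := hφ.mem_ball j _ hz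
        rw [← iterComp_succ_apply, Metric.mem_ball, dist_eq_norm] at hz'
        have := norm_sub_le_norm_sub_add_norm_sub (iterComp φ (j + 1) w)
          (iterComp φ (j + 1) z) (c j)
        rw [norm_sub_rev (iterComp φ (j + 1) w) (iterComp φ (j + 1) z)] at this
        constructor <;> linarith
      have hxy1 : ‖iterComp φ (j + 1) x - c j‖ ≤ 63 * ρ j ∧
          ‖iterComp φ (j + 1) y - c j‖ ≤ 63 * ρ j := by
        rcases hAj with hx | hy
        · exact hclose x y hx hd1
        · exact (hclose y x hy (by rw [norm_sub_rev]; exact hd1)).symm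
      have h50 : 50 * ρ (j + 1 + k') ≤ ρ j := by
        rcases hA with hx | hy
        · rw [e1, Metric.mem_ball, dist_eq_norm] at hx
          exact h.radius_le (by omega) hxy1.1 (by linarith)
        · rw [e2, Metric.mem_ball, dist_eq_norm] at hy
          exact h.radius_le (by omega) hxy1.2 (by linarith)
      calc 2 ^ (k + 1) * (d 0 / ρ 0) = 2 * (2 ^ k * (d 0 / ρ 0)) := by ring
        _ ≤ 2 * (d j / ρ j) := by gcongr
        _ = (2 * d j) / ρ j := by ring
        _ ≤ (2 * d j) / (50 * ρ (j + 1 + k')) :=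
          div_le_div_of_nonneg_left (by linarith [hd j]) (by positivity) h50
        _ ≤ (50 * d (j + 1)) / (50 * ρ (j + 1 + k')) := by
          have := hd (j + 1)
          exact div_le_div_of_nonneg_right (by linarith) (by positivity)
        _ = d (j + 1 + k') / ρ (j + 1 + k') := by
          rw [e, mul_div_mul_left _ _ (by norm_num)]
  have hq : 0 < d 0 / ρ 0 := div_pos (hd 0) (h.pos 0)
  obtain ⟨k, hk⟩ := pow_unbounded_of_one_lt (30 / (d 0 / ρ 0)) (one_lt_two (α := ℝ))
  obtain ⟨j, -, hj⟩ := hgrow k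
  rw [div_lt_iff₀ hq] at hk
  have : d j / ρ j ≤ 30 := by rw [div_le_iff₀ (h.pos j)]; exact hd30 j
  linarith

lemma IsPushSequence.isClosedMap_lim (hφ : IsPushSequence c ρ φ) (h : IsSparse c ρ) :
    IsClosedMap (hφ.lim h) := by
  have : ProperSpace E := FiniteDimensional.proper ℝ E
  refine (isProperMap_iff_tendsto_cocompact.2 ⟨hφ.continuous_lim h, ?_⟩).isClosedMap
  rw [← Metric.cobounded_eq_cocompact, ← comap_norm_atTop, tendsto_comap_iff]
  refine tendsto_atTop_mono (f := fun x => ‖x‖ - 15 * ρ 0) (fun x => ?_)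
    (tendsto_atTop_add_const_right _ _ tendsto_comap)
  have h1 := hφ.norm_lim_sub_le h x 0
  have h2 : ‖x‖ - ‖hφ.lim h x‖ ≤ ‖x - hφ.lim h x‖ := norm_sub_norm_le _ _
  rw [norm_sub_rev] at h2
  change ‖hφ.lim h x - x‖ ≤ _ at h1
  simp only [Function.comp_apply]
  linarith

lemma IsPushSequence.surjective_lim (hφ : IsPushSequence c ρ φ) (h : IsSparse c ρ) :
    Function.Surjective (hφ.lim h) := by
  intro y
  have hcl : IsClosed (range (hφ.lim h)) := (hφ.isClosedMap_lim h).isClosed_range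
  change y ∈ range (hφ.lim h)
  rw [← hcl.closure_eq]
  refine mem_closure_of_tendsto (f := fun n => hφ.lim h ((iterComp φ n).symm y)) (b := atTop) ?_
    (Eventually.of_forall fun n => mem_range_self _)
  rw [tendsto_iff_norm_sub_tendsto_zero]
  refine squeeze_zero (fun _ => norm_nonneg _) (fun n => ?_)
    (by simpa using h.tendsto.const_mul 15)
  have := hφ.norm_lim_sub_le h ((iterComp φ n).symm y) n
  rwa [Homeomorph.apply_symm_apply] at this

/-- A closed set with empty interior can be pushed off a sparse family of balls by a homeomorphism
that is close to the identity. -/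
theorem IsSparse.exists_homeomorph (h : IsSparse c ρ) {Z : Set E} (hZ : IsClosed Z)
    (hZi : interior Z = ∅) :
    ∃ F : E ≃ₜ E, (∀ x, ‖F x - x‖ ≤ 15 * ρ 0) ∧ ∀ x ∈ Z, ∀ i, F x ∉ ball (c i) (ρ i) := by
  -- The homeomorphism `φ n` pushes the image of `Z` under the preceding ones.
  have step : ∀ (n : ℕ) (G : E ≃ₜ E), ∃ ψ : E ≃ₜ E, (∀ x, x ∉ ball (c n) (7 * ρ n) → ψ x = x) ∧
      (∀ x, x ∈ ball (c n) (7 * ρ n) → ψ x ∈ ball (c n) (7 * ρ n)) ∧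
      (∀ x y, ‖x - y‖ ≤ 3 * ‖ψ x - ψ y‖) ∧ ∀ x ∈ Z, ψ (G x) ∉ ball (c n) (2 * ρ n) := by
    intro n G
    obtain ⟨ψ, h1, h2, h3, h4⟩ := exists_homeomorph_push_off (Z := G '' Z)
      (G.isClosedMap _ hZ) (by rw [← G.image_interior, hZi, image_empty]) (c n) (h.pos n)
    exact ⟨ψ, h1, h2, h3, fun x hx => h4 _ (mem_image_of_mem _ hx)⟩
  choose ψ hψ1 hψ2 hψ3 hψ4 using step
  let G : ℕ → E ≃ₜ E := fun n => Nat.rec (Homeomorph.refl E) (fun k F => F.trans (ψ k F)) n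
  let φ : ℕ → E ≃ₜ E := fun n => ψ n (G n)
  have hG : ∀ n, G n = iterComp φ n := by
    intro n
    induction n with
    | zero => rfl
    | succ n ih => rw [iterComp, ← ih]
  have hφ : IsPushSequence c ρ φ :=
    ⟨fun n => hψ1 n _, fun n => hψ2 n _, fun n => hψ3 n _⟩
  have hφZ : ∀ n, ∀ x ∈ Z, iterComp φ (n + 1) x ∉ ball (c n) (2 * ρ n) := fun n x hx => by
    rw [iterComp_succ_apply, ← hG]
    exact hψ4 n _ x hx
  let F : E ≃ₜ E := (Equiv.ofBijective _ ⟨hφ.injective_lim h, hφ.surjective_lim h⟩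
    ).toHomeomorphOfContinuousClosed (hφ.continuous_lim h) (hφ.isClosedMap_lim h)
  refine ⟨F, fun x => hφ.norm_lim_sub_le h x 0, fun x hx i hi => ?_⟩
  change hφ.lim h x ∈ _ at hi
  rw [Metric.mem_ball, dist_eq_norm] at hi
  have h1 := hφ.norm_lim_sub_le h x (i + 1)
  have h2 := h.anti (Nat.le_succ i)
  have hp := h.pos i
  have h4 := norm_sub_le_norm_sub_add_norm_sub (iterComp φ (i + 1) x) (hφ.lim h x) (c i)
  rw [norm_sub_rev (iterComp φ (i + 1) x) (hφ.lim h x)] at h4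
  have h3 := hφ.norm_lim_sub_le_of_close h x (Nat.lt_succ_self i) (by
    change ‖iterComp φ (i + 1) x - c i‖ ≤ _
    linarith)
  refine hφZ i x hx ?_
  rw [Metric.mem_ball, dist_eq_norm]
  change ‖hφ.lim h x - iterComp φ (i + 1) x‖ ≤ _ at h3
  linarith

end Limit

/-! ### Enumerations in decreasing order, and loops around a puncture -/

section

/-- An infinite family of positive numbers, only finitely many of which are larger than any given
`ε > 0`, can be listed in decreasing order. -/
lemma exists_antitone_enumeration {ι : Type*} {S : Set ι} (hS : S.Infinite) {r : ι → ℝ}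
    (hr : ∀ i ∈ S, 0 < r i) (hfin : ∀ ε > 0, {i ∈ S | ε ≤ r i}.Finite) :
    ∃ e : ℕ → ι, Function.Injective e ∧ range e = S ∧ Antitone (r ∘ e) := by
  classical
  have step : ∀ F : Finset ι, ∃ i ∈ S, i ∉ F ∧ ∀ j ∈ S, j ∉ F → r j ≤ r i := by
    intro F
    obtain ⟨i₀, hi₀, hi₀F⟩ := hS.exists_notMem_finset F
    have hf : {i | i ∈ S ∧ i ∉ F ∧ r i₀ ≤ r i}.Finite :=
      (hfin _ (hr i₀ hi₀)).subset fun i hi => ⟨hi.1, hi.2.2⟩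
    obtain ⟨i, hi, hmax⟩ := hf.exists_maximalFor r _ ⟨i₀, hi₀, hi₀F, le_rfl⟩
    refine ⟨i, hi.1, hi.2.1, fun j hj hjF => ?_⟩
    by_contra! hlt
    have := hmax ⟨hj, hjF, hi.2.2.trans hlt.le⟩ hlt.le
    linarith
  choose nxt hS' hF hmax using step
  let F : ℕ → Finset ι := fun n => Nat.rec ∅ (fun _ G => insert (nxt G) G) n
  have hF' : ∀ n, F (n + 1) = insert (nxt (F n)) (F n) := fun _ => rfl
  have hmono : Monotone F := monotone_nat_of_le_succ fun n => by
    rw [hF']; exact Finset.subset_insert _ _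
  let e : ℕ → ι := fun n => nxt (F n)
  have hmem : ∀ {m n}, m < n → e m ∈ F n := fun {m n} h =>
    hmono (Nat.succ_le_of_lt h) (by rw [hF']; exact Finset.mem_insert_self _ _)
  have hinj : Function.Injective e := by
    intro m n h
    rcases lt_trichotomy m n with hlt | heq | hlt
    · exact absurd (show nxt (F n) ∈ F n from (show e m = nxt (F n) from h) ▸ hmem hlt) (hF (F n))
    · exact heq
    · exact absurd (show nxt (F m) ∈ F m from (show e n = nxt (F m) from h.symm) ▸ hmem hlt)
        (hF (F m))
  have hanti : Antitone (r ∘ e) := antitone_nat_of_succ_le fun n =>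
    hmax (F n) _ (hS' _) fun h => hF (F (n + 1)) (hmono (Nat.le_succ n) h)
  have hFe : ∀ n, ∀ i ∈ F n, ∃ m, e m = i := by
    intro n
    induction n with
    | zero => intro i hi; simp [F] at hi
    | succ n ih =>
      intro i hi
      rw [hF', Finset.mem_insert] at hi
      rcases hi with rfl | hi
      exacts [⟨n, rfl⟩, ih i hi]
  refine ⟨e, hinj, Subset.antisymm ?_ ?_, hanti⟩
  · rintro _ ⟨n, rfl⟩
    exact hS' _
  · intro i hi
    by_contra hne
    have hall : ∀ n, e n ∈ {j ∈ S | r i ≤ r j} := fun n =>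
      ⟨hS' _, hmax _ i hi fun hiF => hne (hFe n i hiF)⟩
    exact infinite_of_injective_forall_mem hinj hall (hfin _ (hr i hi))

/-- The inclusion of the circle into the punctured plane has no continuous logarithm. -/
lemma not_exists_log_circle (L : C(Circle, ℂ)) : ¬ ∀ z : Circle, Complex.exp (L z) = z := by
  intro hL
  -- This function is odd, so it has a zero; there the exponential of `L z - L (-z)` is positive.
  have hc : Continuous fun z : Circle => (L z - L (-z)).im := by fun_prop
  obtain ⟨z, hz⟩ : ∃ z : Circle, (L z - L (-z)).im = 0 := by
    have h1 : (L (1 : Circle) - L (-1)).im = - (L (-1) - L (- -1)).im := by simp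
    rcases le_total (L (1 : Circle) - L (-1)).im 0 with h | h
    · exact mem_range_of_exists_le_of_exists_ge hc ⟨1, h⟩ ⟨-1, by linarith⟩
    · exact mem_range_of_exists_le_of_exists_ge hc ⟨-1, by linarith⟩ ⟨1, h⟩
  have h2 : Complex.exp (L z - L (-z)) = -1 := by
    rw [Complex.exp_sub, hL, hL]
    have : (z : ℂ) ≠ 0 := z.coe_ne_zero
    simp [this]
  have h3 : L z - L (-z) = ((L z - L (-z)).re : ℂ) := by
    apply Complex.ext <;> simp [hz]
  rw [h3, ← Complex.ofReal_exp] at h2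
  have h4 : Real.exp (L z - L (-z)).re = -1 := by exact_mod_cast h2
  linarith [Real.exp_pos (L z - L (-z)).re]

/-- A loop in a space `A` over the punctured plane that projects close to a standard circle is not
null-homotopic. -/
lemma not_nullhomotopic_of_norm_sub_lt {A : Type*} [TopologicalSpace A] (c : C(Circle, A))
    (f : C(A, ℂ)) (hf : ∀ a, f a ≠ 0) {R : ℝ} (hR : 0 < R)
    (h : ∀ z : Circle, ‖f (c z) - R * z‖ < R) : ¬ c.Nullhomotopic := by
  rintro ⟨a, ⟨F⟩⟩
  let f' : C(A, {z : ℂ // z ≠ 0}) := ⟨fun a => ⟨f a, hf a⟩, by fun_prop⟩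
  let H : C(unitInterval × Circle, {z : ℂ // z ≠ 0}) := f'.comp F.symm.toContinuousMap
  have hlift := Complex.isCoveringMap_exp.liftHomotopy_lifts H
    (ContinuousMap.const Circle (Complex.log (f a)))
    (by
      intro z
      apply Subtype.ext
      simp [H, f', Complex.exp_log (hf a)])
  set Φ := Complex.isCoveringMap_exp.liftHomotopy H
    (ContinuousMap.const Circle (Complex.log (f a))) _ with hΦ
  have hexp : ∀ z : Circle, Complex.exp (Φ (1, z)) = f (c z) := fun z => by
    have := congrArg Subtype.val (congrFun hlift (1, z))
    simpa [H, f'] using this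
  have hR' : (R : ℂ) ≠ 0 := by exact_mod_cast hR.ne'
  have hslit : ∀ z : Circle, f (c z) / (R * z) ∈ Complex.slitPlane := fun z => by
    have hz : (z : ℂ) ≠ 0 := z.coe_ne_zero
    have h1 : f (c z) / (R * z) = 1 + (f (c z) - R * z) / (R * z) := by
      field_simp; ring
    rw [h1]
    apply Complex.mem_slitPlane_of_norm_lt_one
    rw [norm_div, norm_mul, Circle.norm_coe, mul_one, Complex.norm_real, Real.norm_of_nonneg hR.le,
      div_lt_one hR]
    exact h z
  have hcont : Continuous fun z : Circle =>
      Φ (1, z) - Complex.log (f (c z) / (R * z)) - Complex.log R := by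
    refine Continuous.sub (Continuous.sub (by fun_prop) ?_) continuous_const
    refine Continuous.clog ?_ hslit
    exact Continuous.div (by fun_prop) (by fun_prop) fun z => mul_ne_zero hR' z.coe_ne_zero
  refine not_exists_log_circle ⟨_, hcont⟩ fun z => ?_
  have hz : (z : ℂ) ≠ 0 := z.coe_ne_zero
  have hfz := hf (c z)
  simp only [ContinuousMap.coe_mk]
  rw [Complex.exp_sub, Complex.exp_sub, hexp, Complex.exp_log hR', Complex.exp_log]
  · field_simp
  · exact div_ne_zero hfz (mul_ne_zero hR' hz)

end

/-! ### Stereographic coordinates -/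

section

/-- The Euclidean plane. -/
abbrev E2 : Type := EuclideanSpace ℝ (Fin 2)

lemma exists_orthonormalBasis_two_eq (p : S2) :
    ∃ b : OrthonormalBasis (Fin 3) ℝ E3, b 2 = (p : E3) := by
  have hp : ‖(p : E3)‖ = 1 := by simp
  obtain ⟨b, hb⟩ := Orthonormal.exists_orthonormalBasis_extension_of_card_eq (𝕜 := ℝ) (E := E3)
    (ι := Fin 3) (by simp) (v := fun _ => (p : E3)) (s := {2}) (by
      constructor
      · intro i; simp
      · intro i j hij; exact absurd (Subsingleton.elim i j) hij)
  exact ⟨b, hb 2 rfl⟩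

variable (b : OrthonormalBasis (Fin 3) ℝ E3)

/-- Inverse stereographic projection from the point `-b 2`, from the plane spanned by `b 0` and
`b 1`, normalized to have derivative an isometry at the origin. -/
def stereoVec (w : E2) : E3 :=
  (4 + ‖w‖ ^ 2)⁻¹ • ((4 * w 0) • b 0 + (4 * w 1) • b 1 + (4 - ‖w‖ ^ 2) • b 2)

lemma inner_stereoVec (w w' : E2) : inner ℝ (stereoVec b w) (stereoVec b w') =
    1 - 8 * ‖w - w'‖ ^ 2 / ((4 + ‖w‖ ^ 2) * (4 + ‖w'‖ ^ 2)) := by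
  have h1 : (4 + ‖w‖ ^ 2) ≠ 0 := by positivity
  have h2 : (4 + ‖w'‖ ^ 2) ≠ 0 := by positivity
  simp only [stereoVec, inner_add_left, inner_add_right, inner_smul_left, inner_smul_right,
    OrthonormalBasis.inner_eq_ite]
  simp
  field_simp
  simp only [EuclideanSpace.real_norm_sq_eq, Fin.sum_univ_two, PiLp.sub_apply]
  ring

lemma norm_stereoVec (w : E2) : ‖stereoVec b w‖ = 1 := by
  have := inner_stereoVec b w w
  rw [real_inner_self_eq_norm_sq] at this
  exact (pow_eq_one_iff_of_nonneg (norm_nonneg _) two_ne_zero).1 (this.trans (by simp))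

/-- Inverse stereographic projection, as a map to the sphere. -/
def stereo (w : E2) : S2 := ⟨stereoVec b w, by simpa using norm_stereoVec b w⟩

lemma dist_stereo_sq (w w' : E2) : dist (stereo b w) (stereo b w') ^ 2 =
    16 * ‖w - w'‖ ^ 2 / ((4 + ‖w‖ ^ 2) * (4 + ‖w'‖ ^ 2)) := by
  change dist (stereoVec b w) (stereoVec b w') ^ 2 = _
  rw [dist_eq_norm, norm_sub_sq_real, norm_stereoVec, norm_stereoVec, inner_stereoVec]
  ring

lemma dist_stereo_le (w w' : E2) : dist (stereo b w) (stereo b w') ≤ ‖w - w'‖ := by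
  apply le_of_sq_le_sq _ (norm_nonneg _)
  rw [dist_stereo_sq, div_le_iff₀ (by positivity)]
  nlinarith [sq_nonneg ‖w - w'‖, mul_nonneg (sq_nonneg ‖w - w'‖) (sq_nonneg ‖w‖),
    mul_nonneg (sq_nonneg ‖w - w'‖) (sq_nonneg ‖w'‖),
    mul_nonneg (mul_nonneg (sq_nonneg ‖w - w'‖) (sq_nonneg ‖w‖)) (sq_nonneg ‖w'‖)]

lemma norm_sub_le_dist_stereo {w w' : E2} (hw : ‖w‖ ≤ 1 / 2) (hw' : ‖w'‖ ≤ 1 / 2) :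
    ‖w - w'‖ ≤ 17 / 16 * dist (stereo b w) (stereo b w') := by
  apply le_of_sq_le_sq _ (by positivity)
  rw [mul_pow, dist_stereo_sq]
  have h1 : 4 + ‖w‖ ^ 2 ≤ 17 / 4 := by nlinarith [norm_nonneg w]
  have h2 : 4 + ‖w'‖ ^ 2 ≤ 17 / 4 := by nlinarith [norm_nonneg w']
  have h3 : (4 + ‖w‖ ^ 2) * (4 + ‖w'‖ ^ 2) ≤ 17 / 4 * (17 / 4) := by gcongr
  rw [mul_div_assoc', le_div_iff₀ (by positivity)]
  nlinarith [sq_nonneg ‖w - w'‖]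

lemma continuous_stereo : Continuous (stereo b) :=
  (LipschitzWith.of_dist_le_mul (K := 1) fun w w' => by
    simpa [dist_eq_norm] using dist_stereo_le b w w').continuous

/-- Stereographic projection from the point `-b 2`. -/
def stereoProj (x : S2) : E2 :=
  !₂[2 * inner ℝ (b 0) (x : E3) / (1 + inner ℝ (b 2) (x : E3)),
    2 * inner ℝ (b 1) (x : E3) / (1 + inner ℝ (b 2) (x : E3))]

lemma stereoProj_stereo (w : E2) : stereoProj b (stereo b w) = w := by
  have h1 : (4 + ‖w‖ ^ 2) ≠ 0 := by positivity
  have hi : ∀ i, inner ℝ (b i) (stereo b w : E3) = inner ℝ (b i) (stereoVec b w) := fun _ => rfl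
  ext i
  fin_cases i <;>
  · simp only [stereoProj, hi, stereoVec, inner_add_right, inner_smul_right,
      OrthonormalBasis.inner_eq_ite]
    simp
    field_simp
    ring

lemma stereo_injective : Function.Injective (stereo b) :=
  Function.LeftInverse.injective (stereoProj_stereo b)

lemma stereo_stereoProj {x : S2} (hx : inner ℝ (b 2) (x : E3) ≠ -1) :
    stereo b (stereoProj b x) = x := by
  apply Subtype.ext
  have hx1 : ‖(x : E3)‖ = 1 := by simp
  have hs := b.sum_repr' (x : E3)
  rw [Fin.sum_univ_three] at hs
  have hn := b.sum_sq_norm_inner_right (x : E3)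
  rw [Fin.sum_univ_three, hx1] at hn
  simp only [Real.norm_eq_abs, sq_abs] at hn
  change stereoVec b (stereoProj b x) = x
  rw [stereoVec]
  have hw : ‖stereoProj b x‖ ^ 2 = ((2 * inner ℝ (b 0) (x : E3)) / (1 + inner ℝ (b 2) (x : E3))) ^ 2
      + ((2 * inner ℝ (b 1) (x : E3)) / (1 + inner ℝ (b 2) (x : E3))) ^ 2 := by
    rw [EuclideanSpace.real_norm_sq_eq, Fin.sum_univ_two]
    simp [stereoProj]
  have h0 : stereoProj b x 0 = 2 * inner ℝ (b 0) (x : E3) / (1 + inner ℝ (b 2) (x : E3)) := by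
    simp [stereoProj]
  have h1 : stereoProj b x 1 = 2 * inner ℝ (b 1) (x : E3) / (1 + inner ℝ (b 2) (x : E3)) := by
    simp [stereoProj]
  rw [h0, h1, hw]
  conv_rhs => rw [← hs]
  set α : ℝ := inner ℝ (b 0) (x : E3)
  set β : ℝ := inner ℝ (b 1) (x : E3)
  set h : ℝ := inner ℝ (b 2) (x : E3)
  have hh : 1 + h ≠ 0 := fun e => hx (by linarith)
  have hαβ : α ^ 2 + β ^ 2 = (1 - h) * (1 + h) := by linarith
  have e1 : (2 * α / (1 + h)) ^ 2 + (2 * β / (1 + h)) ^ 2 = 4 * (1 - h) / (1 + h) := by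
    have : (2 * α / (1 + h)) ^ 2 + (2 * β / (1 + h)) ^ 2 = 4 * (α ^ 2 + β ^ 2) / (1 + h) ^ 2 := by
      field_simp
      ring
    rw [this, hαβ]
    field_simp
  have e2 : 4 + 4 * (1 - h) / (1 + h) = 8 / (1 + h) := by field_simp; ring
  have e3 : 4 - 4 * (1 - h) / (1 + h) = 8 * h / (1 + h) := by field_simp; ring
  rw [e1, e2, e3, smul_add, smul_add, smul_smul, smul_smul, smul_smul]
  congr 2 <;> congr 1 <;> field_simp <;> ring

lemma continuousOn_stereoProj :
    ContinuousOn (stereoProj b) {x : S2 | inner ℝ (b 2) (x : E3) ≠ -1} := by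
  have hd : ∀ i, ContinuousOn (fun x : S2 => 2 * inner ℝ (b i) (x : E3) /
      (1 + inner ℝ (b 2) (x : E3))) {x : S2 | inner ℝ (b 2) (x : E3) ≠ -1} := fun i => by
    refine ContinuousOn.div (by fun_prop) (by fun_prop) fun x hx e => hx (by linarith)
  refine (PiLp.continuous_toLp 2 _).comp_continuousOn (continuousOn_pi.2 fun i => ?_)
  fin_cases i
  · exact hd 0
  · exact hd 1

lemma inner_two_stereo_ne (w : E2) : inner ℝ (b 2) (stereo b w : E3) ≠ -1 := by
  change inner ℝ (b 2) (stereoVec b w) ≠ -1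
  have h1 : (4 + ‖w‖ ^ 2) ≠ 0 := by positivity
  simp only [stereoVec, inner_add_right, inner_smul_right, OrthonormalBasis.inner_eq_ite]
  simp
  intro e
  field_simp at e
  linarith

lemma isOpenMap_stereo : IsOpenMap (stereo b) := by
  intro U hU
  have ho : IsOpen {x : S2 | inner ℝ (b 2) (x : E3) ≠ -1} :=
    isOpen_ne_fun (by fun_prop) continuous_const
  have : stereo b '' U = {x : S2 | inner ℝ (b 2) (x : E3) ≠ -1} ∩ stereoProj b ⁻¹' U := by
    ext x
    constructor
    · rintro ⟨w, hw, rfl⟩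
      exact ⟨inner_two_stereo_ne b w, by simpa [stereoProj_stereo] using hw⟩
    · rintro ⟨hx, hxU⟩
      exact ⟨_, hxU, stereo_stereoProj b hx⟩
  rw [this]
  exact (continuousOn_stereoProj b).isOpen_inter_preimage ho hU

variable {b} {p : S2}

lemma stereo_zero (hb : b 2 = (p : E3)) : stereo b 0 = p := by
  apply Subtype.ext
  change stereoVec b 0 = p
  rw [stereoVec, ← hb]
  simp

lemma inner_two_ne_of_dist_lt (hb : b 2 = (p : E3)) {x : S2} (hx : dist x p < 2) :
    inner ℝ (b 2) (x : E3) ≠ -1 := by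
  intro e
  have hx1 : ‖(x : E3)‖ = 1 := by simp
  have hp1 : ‖(p : E3)‖ = 1 := by simp
  have : dist x p ^ 2 = 4 := by
    rw [Subtype.dist_eq, dist_eq_norm, norm_sub_sq_real, hx1, hp1, real_inner_comm, ← hb, e]
    norm_num
  nlinarith [dist_nonneg (x := x) (y := p)]

/-- Points near `p` are covered by a neighbourhood of the origin of comparable size. -/
lemma exists_stereo_eq (hb : b 2 = (p : E3)) {x : S2} (hx : dist x p ≤ 1 / 4) :
    ∃ w : E2, stereo b w = x ∧ ‖w‖ ≤ 17 / 16 * dist x p := by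
  have hw := stereo_stereoProj b (inner_two_ne_of_dist_lt hb (x := x) (by linarith))
  refine ⟨_, hw, ?_⟩
  set w := stereoProj b x
  have h1 := dist_stereo_sq b w 0
  rw [stereo_zero hb, hw] at h1
  simp only [sub_zero, norm_zero] at h1
  rw [eq_div_iff (by positivity)] at h1
  apply le_of_sq_le_sq _ (by positivity)
  have h2 : dist x p ^ 2 ≤ 1 / 16 := by nlinarith [dist_nonneg (x := x) (y := p)]
  have h3 := sq_nonneg ‖w‖
  nlinarith

lemma isPreconnected_ball_sphere {ρ : ℝ} (hρ : ρ ≤ 1) : IsPreconnected (ball p ρ) := by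
  obtain hρ0 | hρ0 := le_or_gt ρ 0
  · rw [ball_eq_empty.2 hρ0]
    exact isPreconnected_empty
  obtain ⟨b, hb⟩ := exists_orthonormalBasis_two_eq p
  have : ball p ρ = stereo b '' {w | dist (stereo b w) p < ρ} := by
    ext x
    constructor
    · intro hx
      rw [mem_ball] at hx
      have := stereo_stereoProj b (inner_two_ne_of_dist_lt hb (x := x) (by linarith))
      exact ⟨stereoProj b x, by simpa [this] using hx, this⟩
    · rintro ⟨w, hw, rfl⟩
      exact hw
  rw [this]
  refine IsPreconnected.image ?_ _ (continuous_stereo b).continuousOn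
  -- The condition on `w` only depends on its norm, monotonically.
  refine (StarConvex.isPathConnected (a := 0) ?_ ?_).isConnected.isPreconnected
  swap
  · simpa [stereo_zero hb] using hρ0
  intro w hw s t hs ht hst
  simp only [smul_zero, zero_add, mem_ofPred_eq] at hw ⊢
  refine lt_of_le_of_lt ?_ hw
  apply le_of_sq_le_sq _ dist_nonneg
  have e : ∀ w : E2, dist (stereo b w) p ^ 2 = 4 * ‖w‖ ^ 2 / (4 + ‖w‖ ^ 2) := fun w => by
    have := dist_stereo_sq b w 0
    rw [stereo_zero hb] at this
    rw [this]
    simp only [sub_zero, norm_zero]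
    field_simp
    ring
  rw [e, e, norm_smul, Real.norm_of_nonneg ht, div_le_div_iff₀ (by positivity) (by positivity)]
  have h1 : (t * ‖w‖) ^ 2 ≤ ‖w‖ ^ 2 := by
    have : t * ‖w‖ ≤ 1 * ‖w‖ := by gcongr; linarith
    rw [one_mul] at this
    gcongr
  nlinarith

end

/-! ### Separated families of points of the sphere -/

section

instance : Fact (1 < Module.rank ℝ E3) :=
  ⟨by rw [← Module.finrank_eq_rank]; simp⟩

instance : ConnectedSpace S2 :=
  isConnected_iff_connectedSpace.1 (isConnected_sphere Fact.out _ zero_le_one)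

lemma dist_neg_self (p : S2) : dist (-p) p = 2 := by
  have hp : ‖(p : E3)‖ = 1 := by simp
  rw [Subtype.dist_eq, dist_eq_norm]
  have : ((-p : S2) : E3) - p = (-2 : ℝ) • (p : E3) := by
    rw [coe_neg_sphere]; module
  rw [this, norm_smul, hp]
  norm_num

instance : Nontrivial S2 := by
  let b : OrthonormalBasis (Fin 3) ℝ E3 := EuclideanSpace.basisFun _ _
  refine ⟨stereo b 0, - stereo b 0, fun h => ?_⟩
  have := dist_neg_self (stereo b 0)
  rw [← h, dist_self] at this
  norm_num at this

/-- A dense family of points of the sphere with weights, that behaves like the base points of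
disjoint horoballs. -/
structure IsSeparatedFamily {ι : Type*} (x : ι → S2) (r : ι → ℝ) : Prop where
  pos : ∀ i, 0 < r i
  le_one : ∀ i, r i ≤ 1
  sep : ∀ i j, i ≠ j → 2 * Real.sqrt (r i * r j) ≤ dist (x i) (x j)
  dense : DenseRange x

/-- Only finitely many members of a separated family of points of the sphere have a weight that
exceeds a given number. -/
lemma finite_setOf_le_of_sep {ι : Type*} {x : ι → S2} {r : ι → ℝ}
    (sep : ∀ i j, i ≠ j → 2 * Real.sqrt (r i * r j) ≤ dist (x i) (x j)) {ε : ℝ} (hε : 0 < ε) :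
    {i | ε ≤ r i}.Finite := by
  obtain ⟨t, -, ht, hcov⟩ := (isCompact_univ (X := S2)).finite_cover_balls hε
  have hy : ∀ i, ∃ y ∈ t, x i ∈ ball y ε := fun i => by
    simpa using hcov (mem_univ (x i))
  choose y hyt hy using hy
  refine Set.Finite.of_injOn (f := y) (t := t) (fun i _ => hyt i) (fun i hi j hj hij => ?_) ht
  by_contra hne
  have h1 := sep i j hne
  have h2 : ε ≤ Real.sqrt (r i * r j) := by
    apply Real.le_sqrt_of_sq_le
    rw [sq]
    exact mul_le_mul hi hj hε.le (hε.le.trans hi)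
  have h3 := hy i
  have h4 := hy j
  rw [← hij] at h4
  rw [mem_ball] at h3 h4
  have := dist_triangle_right (x i) (x j) (y i)
  linarith

lemma countable_of_sep {ι : Type*} {x : ι → S2} {r : ι → ℝ} (pos : ∀ i, 0 < r i)
    (sep : ∀ i j, i ≠ j → 2 * Real.sqrt (r i * r j) ≤ dist (x i) (x j)) : Countable ι := by
  have : (⋃ n : ℕ, {i | 1 / ((n : ℝ) + 1) ≤ r i}).Countable :=
    countable_iUnion fun n => (finite_setOf_le_of_sep sep (by positivity)).countable
  rw [← countable_univ_iff]
  refine this.mono fun i _ => ?_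
  obtain ⟨n, hn⟩ := exists_nat_one_div_lt (pos i)
  exact mem_iUnion.2 ⟨n, hn.le⟩

variable {ι : Type*} {x : ι → S2} {r : ι → ℝ}

/-- Points of the family that are close to `x i`, relative to `r i`, have a small weight. -/
lemma IsSeparatedFamily.le_of_dist_le (h : IsSeparatedFamily x r) {i j : ι} (hij : j ≠ i) {l : ℝ}
    (hd : dist (x j) (x i) ≤ 2 * l * r i) : r j ≤ l ^ 2 * r i := by
  have h1 := h.sep j i hij
  have hi := h.pos i
  have hj := h.pos j
  have h2 : Real.sqrt (r j * r i) ≤ l * r i := by linarith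
  have h3 : 0 ≤ l * r i := (Real.sqrt_nonneg _).trans h2
  rw [Real.sqrt_le_left h3] at h2
  have : r i * r j ≤ r i * (l ^ 2 * r i) := by linarith
  exact le_of_mul_le_mul_left this hi

lemma IsSeparatedFamily.infinite_near (h : IsSeparatedFamily x r) (i : ι) {ε : ℝ} (hε : 0 < ε) :
    {j | j ≠ i ∧ dist (x j) (x i) < ε}.Infinite := by
  intro hfin
  have hd : Dense (range x \ (insert (x i) (x '' {j | j ≠ i ∧ dist (x j) (x i) < ε}))) :=
    h.dense.sdiff_finite ((hfin.image x).insert _)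
  obtain ⟨_, ⟨⟨j, rfl⟩, hj⟩, hy⟩ := hd.exists_mem_open isOpen_ball ⟨x i, mem_ball_self hε⟩
  apply hj
  by_cases hji : j = i
  · exact Or.inl (by rw [hji])
  · exact Or.inr ⟨j, ⟨hji, hy⟩, rfl⟩

/-- The homeomorphism of the plane that pushes the circle of radius `l * r i / 2` off the small
balls around the other points of the family close to `x i`. -/
lemma IsSeparatedFamily.exists_homeomorph_plane (h : IsSeparatedFamily x r) {l : ℝ} (hl : 0 < l)
    (hl1 : l ≤ 1 / 1000) (i : ι) {b : OrthonormalBasis (Fin 3) ℝ E3} (hb : b 2 = (x i : E3)) :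
    ∃ F : E2 ≃ₜ E2, (∀ w, ‖F w - w‖ ≤ l * r i / 100) ∧ ∀ w, ‖w‖ = l * r i / 2 → ∀ j ≠ i,
      dist (x j) (x i) < 2 * l * r i →
        3 * l * r j / 4 ≤ dist (stereo b (F w)) (x j) := by
  have hri := h.pos i
  have hri1 := h.le_one i
  have hlri : l * r i ≤ 1 / 1000 := by nlinarith
  obtain ⟨e, he, her, hea⟩ := exists_antitone_enumeration
    (h.infinite_near i (ε := 2 * l * r i) (by positivity)) (r := r) (fun j _ => h.pos j)
    (fun ε hε => (finite_setOf_le_of_sep h.sep hε).subset fun j hj => hj.2)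
  have hmem : ∀ n, e n ≠ i ∧ dist (x (e n)) (x i) < 2 * l * r i := fun n => by
    have : e n ∈ range e := mem_range_self n
    rwa [her] at this
  have hc : ∀ n, ∃ w : E2, stereo b w = x (e n) ∧ ‖w‖ ≤ 1 / 2 := fun n => by
    obtain ⟨h1, h2⟩ := hmem n
    obtain ⟨w, hw, hw'⟩ := exists_stereo_eq hb (x := x (e n)) (by linarith)
    exact ⟨w, hw, by linarith⟩
  choose c hc hc' using hc
  have hsmall : ∀ n, r (e n) ≤ l ^ 2 * r i := fun n =>
    h.le_of_dist_le (hmem n).1 (hmem n).2.le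
  have hsp : IsSparse c fun n => l * r (e n) := by
    refine ⟨fun n => mul_pos hl (h.pos _), fun m n hmn => ?_, ?_, fun m n hmn => ?_⟩
    · have := hea hmn
      simp only [Function.comp_apply] at this
      gcongr
    · have : Tendsto (fun n => r (e n)) atTop (𝓝 0) := by
        rw [Metric.tendsto_atTop']
        intro ε hε
        have hf : (e ⁻¹' {j | ε ≤ r j}).Finite :=
          (finite_setOf_le_of_sep h.sep hε).preimage he.injOn
        obtain ⟨N, hN⟩ := hf.bddAbove
        refine ⟨N, fun n hn => ?_⟩
        rw [Real.dist_eq, sub_zero, abs_of_pos (h.pos _)]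
        by_contra! hcon
        exact absurd (hN hcon) (not_le.2 hn)
      simpa using this.const_mul l
    · have h1 := h.sep _ _ (he.ne hmn)
      rw [← hc m, ← hc n] at h1
      have h2 := dist_stereo_le b (c m) (c n)
      have h3 : Real.sqrt (l * r (e m) * (l * r (e n))) = l * Real.sqrt (r (e m) * r (e n)) := by
        rw [show l * r (e m) * (l * r (e n)) = l ^ 2 * (r (e m) * r (e n)) by ring,
          Real.sqrt_mul (by positivity), Real.sqrt_sq hl.le]
      rw [h3]
      nlinarith [Real.sqrt_nonneg (r (e m) * r (e n))]
  obtain ⟨F, hF1, hF2⟩ := hsp.exists_homeomorph (Z := sphere 0 (l * r i / 2)) isClosed_sphere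
    (interior_sphere _ (by positivity))
  have hF1' : ∀ w, ‖F w - w‖ ≤ l * r i / 100 := fun w => by
    refine (hF1 w).trans ?_
    have h0 := hsmall 0
    have : l ^ 2 * r i ≤ 1 / 1500 * r i := by
      gcongr; nlinarith
    nlinarith
  refine ⟨F, hF1', fun w hw j hji hj => ?_⟩
  obtain ⟨n, rfl⟩ : j ∈ range e := by rw [her]; exact ⟨hji, hj⟩
  by_contra! hcon
  refine hF2 w (by simpa using hw) n ?_
  have hFw : ‖F w‖ ≤ 1 / 2 := by
    have h1 := hF1' w
    have h2 := norm_le_norm_add_norm_sub' (F w) w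
    linarith
  rw [← hc n] at hcon
  have := norm_sub_le_dist_stereo b hFw (hc' n)
  rw [mem_ball, dist_eq_norm]
  have hp := mul_pos hl (h.pos (e n))
  linarith

/-- The unit circle of `ℂ` as the boundary of the closed unit disk. -/
def circleToDisk : C(Circle, Disk) :=
  ⟨fun z => ⟨!₂[(z : ℂ).re, (z : ℂ).im], by
    have := Circle.normSq_coe z
    rw [Complex.normSq_apply] at this
    rw [mem_closedBall, dist_zero_right, ← sq_le_one_iff₀ (norm_nonneg _),
      EuclideanSpace.real_norm_sq_eq, Fin.sum_univ_two]
    simp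
    linarith⟩, by
    refine Continuous.subtype_mk ((PiLp.continuous_toLp 2 _).comp (continuous_pi fun k => ?_)) _
    fin_cases k
    · exact Complex.continuous_re.comp continuous_subtype_val
    · exact Complex.continuous_im.comp continuous_subtype_val⟩

lemma circleToDisk_val (z : Circle) :
    (circleToDisk z : E2) = !₂[(z : ℂ).re, (z : ℂ).im] := rfl

lemma range_circleToDisk : range circleToDisk = {y : Disk | ‖(y : E2)‖ = 1} := by
  ext y
  constructor
  · rintro ⟨z, rfl⟩
    have := Circle.normSq_coe z
    rw [Complex.normSq_apply] at this
    rw [mem_ofPred_eq, ← pow_eq_one_iff_of_nonneg (norm_nonneg _) two_ne_zero,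
      EuclideanSpace.real_norm_sq_eq, Fin.sum_univ_two, circleToDisk_val]
    simp
    linarith
  · intro hy
    rw [mem_ofPred_eq, ← pow_eq_one_iff_of_nonneg (norm_nonneg _) two_ne_zero,
      EuclideanSpace.real_norm_sq_eq, Fin.sum_univ_two] at hy
    obtain ⟨z, hz⟩ : ∃ z : Circle, (z : ℂ) = ⟨(y : E2) 0, (y : E2) 1⟩ := by
      refine ⟨⟨_, mem_sphere_zero_iff_norm.2 ?_⟩, rfl⟩
      rw [← pow_eq_one_iff_of_nonneg (norm_nonneg _) two_ne_zero, ← Complex.normSq_eq_norm_sq,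
        Complex.normSq_apply]
      linarith
    refine ⟨z, Subtype.ext ?_⟩
    rw [circleToDisk_val, hz]
    ext k
    fin_cases k <;> simp

lemma circleToDisk_injective : Function.Injective circleToDisk := by
  intro z w hzw
  have h := congrArg (fun y : Disk => (y : E2)) hzw
  simp only [circleToDisk_val] at h
  have h0 := congrArg (fun v : E2 => v 0) h
  have h1 := congrArg (fun v : E2 => v 1) h
  simp at h0 h1
  exact Circle.ext (Complex.ext h0 h1)

end

/-! ### Disks adapted to a separated family -/

section

lemma closure_diskInterior (e : C(Disk, S2)) : closure (diskInterior e) = range e := by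
  have hd : closure {y : Disk | ‖(y : E2)‖ < 1} = univ := by
    have : {y : Disk | ‖(y : E2)‖ < 1} = Subtype.val ⁻¹' ball (0 : E2) 1 := by
      ext y; simp
    refine eq_univ_of_forall fun y => ?_
    rw [this, closure_subtype, Subtype.image_preimage_coe,
      inter_eq_right.2 ball_subset_closedBall, closure_ball _ one_ne_zero]
    exact y.2
  apply Subset.antisymm
  · exact closure_minimal (image_subset_range _ _) (isCompact_range e.continuous).isClosed
  · rw [← image_univ, ← hd]
    exact image_closure_subset_closure_image e.continuous

lemma diskInterior_union_diskBoundary (e : C(Disk, S2)) :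
    diskInterior e ∪ diskBoundary e = range e := by
  rw [diskInterior, diskBoundary, ← image_union, ← image_univ]
  congr 1
  refine eq_univ_of_forall fun y => ?_
  have : ‖(y : E2)‖ ≤ 1 := mem_closedBall_zero_iff.1 y.2
  exact this.lt_or_eq

lemma disjoint_diskInterior_diskBoundary {e : C(Disk, S2)} (he : IsEmbedding e) :
    Disjoint (diskInterior e) (diskBoundary e) := by
  rw [diskInterior, diskBoundary, disjoint_image_iff he.injective, disjoint_left]
  intro y hy hy'
  simp only [mem_ofPred_eq] at hy hy'
  linarith

variable {ι : Type*} {x : ι → S2} {r : ι → ℝ}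

/-- A closed disk about `x i` whose boundary is an essential circle in the annulus about `x i` and
avoids the balls about the other points of smaller weight. -/
structure IsGoodDisk (x : ι → S2) (r : ι → ℝ) (l : ℝ) (i : ι) (e : C(Disk, S2)) : Prop where
  isEmbedding : IsEmbedding e
  isOpen : IsOpen (diskInterior e)
  ball_subset : ball (x i) (l / 4 * r i) ⊆ diskInterior e
  range_subset : range e ⊆ ball (x i) (3 * l * r i / 4)
  disjoint : ∀ j ≠ i, r j ≤ r i → Disjoint (diskBoundary e) (ball (x j) (3 * l * r j / 4))
  essential : IsEssentialCircle
    (ball (x i) (3 * l * r i / 4) \ ball (x i) (l * r i / 4)) (diskBoundary e)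

/-- The disk is the image of a round disk under the homeomorphism that pushes its boundary off the
small balls. -/
theorem IsSeparatedFamily.exists_isGoodDisk (h : IsSeparatedFamily x r) {l : ℝ} (hl : 0 < l)
    (hl1 : l ≤ 1 / 1000) (i : ι) : ∃ e : C(Disk, S2), IsGoodDisk x r l i e := by
  obtain ⟨b, hb⟩ := exists_orthonormalBasis_two_eq (x i)
  obtain ⟨F, hF, hFd⟩ := h.exists_homeomorph_plane hl hl1 i hb
  have hri := h.pos i
  have hri1 := h.le_one i
  have hlr : 0 < l * r i := mul_pos hl hri
  have hlri : l * r i ≤ 1 / 1000 := by nlinarith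
  set R := l * r i / 2 with hR
  have hRpos : 0 < R := by positivity
  let g : E2 → S2 := fun w => stereo b (F (R • w))
  have hg : Continuous g := (continuous_stereo b).comp (F.continuous.comp (by fun_prop))
  have hginj : Function.Injective g := fun w w' hww => by
    have := F.injective (stereo_injective b hww)
    exact smul_right_injective _ hRpos.ne' this
  let e : C(Disk, S2) := ⟨fun w => g w, hg.comp continuous_subtype_val⟩
  have hFnorm : ∀ w : E2, |‖F (R • w)‖ - R * ‖w‖| ≤ R / 50 := fun w => by
    have h1 := abs_norm_sub_norm_le (F (R • w)) (R • w)
    rw [norm_smul, Real.norm_of_nonneg hRpos.le] at h1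
    have := hF (R • w)
    linarith
  have hdist : ∀ w : E2, ‖w‖ ≤ 1 → dist (g w) (x i) ≤ 51 / 50 * R := fun w hw => by
    have h1 := dist_stereo_le b (F (R • w)) 0
    rw [stereo_zero hb, sub_zero] at h1
    have h2 := (abs_le.1 (hFnorm w)).2
    change dist (stereo b (F (R • w))) _ ≤ _
    nlinarith
  have hdist' : ∀ w : E2, ‖w‖ = 1 → 3 / 4 * R ≤ dist (g w) (x i) := fun w hw => by
    obtain ⟨h2, h3⟩ := abs_le.1 (hFnorm w)
    rw [hw] at h2 h3
    have h1 := norm_sub_le_dist_stereo b (w := F (R • w)) (w' := 0) (by linarith) (by simp)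
    rw [stereo_zero hb, sub_zero] at h1
    change _ ≤ dist (stereo b (F (R • w))) _
    linarith
  have hint : diskInterior e = g '' ball 0 1 := by
    ext y
    constructor
    · rintro ⟨w, hw, rfl⟩
      exact ⟨w, by simpa using hw, rfl⟩
    · rintro ⟨w, hw, rfl⟩
      exact ⟨⟨w, ball_subset_closedBall hw⟩, by simpa using hw, rfl⟩
  have hbd : diskBoundary e = range fun z => e (circleToDisk z) := by
    rw [diskBoundary, ← range_circleToDisk, ← range_comp]
    rfl
  have hcirc : ∀ z : Circle, ‖(circleToDisk z : E2)‖ = 1 := fun z => by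
    have : circleToDisk z ∈ range circleToDisk := mem_range_self z
    rwa [range_circleToDisk] at this
  have hopen : IsOpen (diskInterior e) := by
    rw [hint]
    refine (((isOpenMap_stereo b).comp F.isOpenMap).comp ?_) _ isOpen_ball
    exact isOpenMap_smul₀ hRpos.ne'
  refine ⟨e, ?_, hopen, ?_, ?_, ?_, ?_⟩
  · exact (e.continuous.isClosedEmbedding
      (hginj.comp Subtype.val_injective)).isEmbedding
  · intro y hy
    rw [mem_ball] at hy
    obtain ⟨w, rfl, hw⟩ := exists_stereo_eq hb (x := y) (by linarith)
    rw [hint]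
    refine ⟨R⁻¹ • F.symm w, ?_, ?_⟩
    · have h1 := hF (F.symm w)
      rw [F.apply_symm_apply] at h1
      have h2 := norm_sub_norm_le (F.symm w) w
      rw [norm_sub_rev] at h2
      rw [mem_ball_zero_iff, norm_smul, norm_inv, Real.norm_of_nonneg hRpos.le,
        inv_mul_lt_iff₀ hRpos]
      linarith
    · simp only [g]
      rw [smul_inv_smul₀ hRpos.ne', F.apply_symm_apply]
  · rintro _ ⟨w, rfl⟩
    have := hdist w (mem_closedBall_zero_iff.1 w.2)
    rw [mem_ball]
    change dist (g w) _ < _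
    linarith
  · intro j hj hrj
    rw [disjoint_left]
    rintro _ ⟨w, hw, rfl⟩ hwj
    rw [mem_ball] at hwj
    change dist (g w) _ < _ at hwj
    by_cases hnear : dist (x j) (x i) < 2 * l * r i
    · have := hFd (R • (w : E2)) (by
        rw [norm_smul, Real.norm_of_nonneg hRpos.le, show ‖(w : E2)‖ = 1 from hw, mul_one])
        j hj hnear
      exact absurd hwj (not_lt.2 this)
    · have h1 := hdist w (mem_closedBall_zero_iff.1 w.2)
      have h2 := dist_triangle_left (x j) (x i) (g w)
      have h3 : l * r j ≤ l * r i := by gcongr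
      linarith
  · have hA : ∀ z : Circle, e (circleToDisk z) ∈
        ball (x i) (3 * l * r i / 4) \ ball (x i) (l * r i / 4) := fun z => by
      have h1 := hdist _ (hcirc z).le
      have h2 := hdist' _ (hcirc z)
      rw [Set.mem_sdiff, mem_ball, mem_ball, not_lt]
      exact ⟨h1.trans_lt (by linarith), le_trans (by linarith) h2⟩
    let c : C(Circle, (ball (x i) (3 * l * r i / 4) \ ball (x i) (l * r i / 4) : Set S2)) :=
      ⟨fun z => ⟨e (circleToDisk z), hA z⟩, by fun_prop⟩
    have hAne : ∀ a : (ball (x i) (3 * l * r i / 4) \ ball (x i) (l * r i / 4) : Set S2),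
        inner ℝ (b 2) ((a : S2) : E3) ≠ -1 := fun a =>
      inner_two_ne_of_dist_lt hb ((mem_ball.1 a.2.1).trans (by linarith))
    have hproj : Continuous fun a : (ball (x i) (3 * l * r i / 4) \ ball (x i) (l * r i / 4) :
        Set S2) => stereoProj b a :=
      (continuousOn_stereoProj b).comp_continuous continuous_subtype_val hAne
    let f : C((ball (x i) (3 * l * r i / 4) \ ball (x i) (l * r i / 4) : Set S2), ℂ) :=
      ⟨fun a => ⟨stereoProj b a 0, stereoProj b a 1⟩, by
        have : Continuous fun w : E2 => (⟨w 0, w 1⟩ : ℂ) := by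
          have e : (fun w : E2 => (⟨w 0, w 1⟩ : ℂ)) = fun w : E2 => (w 0 : ℂ) + w 1 * Complex.I := by
            ext w; exact Complex.mk_eq_add_mul_I _ _
          rw [e]
          fun_prop
        exact this.comp hproj⟩
    refine ⟨c, ?_, ?_, ?_⟩
    · refine (c.continuous.isClosedEmbedding fun z w hzw => ?_).isEmbedding
      have h1 : g (circleToDisk z) = g (circleToDisk w) := congrArg Subtype.val hzw
      exact circleToDisk_injective (Subtype.ext (hginj h1))
    · refine not_nullhomotopic_of_norm_sub_lt c f (fun a ha => ?_) hRpos fun z => ?_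
      · have h0 : stereoProj b a = 0 := by
          ext k
          fin_cases k
          · exact congrArg Complex.re ha
          · exact congrArg Complex.im ha
        have h1 := stereo_stereoProj b (hAne a)
        rw [h0, stereo_zero hb] at h1
        refine a.2.2 ?_
        rw [← h1]
        exact mem_ball_self (by linarith)
      · have h1 : stereoProj b (c z : S2) = F (R • (circleToDisk z : E2)) :=
          stereoProj_stereo b _
        have h2 : f (c z) - R * z = ⟨(F (R • (circleToDisk z : E2)) - R • (circleToDisk z : E2)) 0,
            (F (R • (circleToDisk z : E2)) - R • (circleToDisk z : E2)) 1⟩ := by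
          change (⟨stereoProj b (c z : S2) 0, stereoProj b (c z : S2) 1⟩ : ℂ) - R * z = _
          rw [h1]
          apply Complex.ext <;> simp [circleToDisk_val]
        have h3 := hF (R • (circleToDisk z : E2))
        refine lt_of_pow_lt_pow_left₀ 2 hRpos.le ?_
        rw [h2, ← Complex.normSq_eq_norm_sq, Complex.normSq_apply]
        have h4 := EuclideanSpace.real_norm_sq_eq
          (F (R • (circleToDisk z : E2)) - R • (circleToDisk z : E2))
        rw [Fin.sum_univ_two] at h4
        nlinarith [norm_nonneg (F (R • (circleToDisk z : E2)) - R • (circleToDisk z : E2))]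
    · exact hbd

end

/-! ### The Sierpinski curve of a separated family -/

section

variable {ι : Type*} {x : ι → S2} {r : ι → ℝ} {l : ℝ}

lemma IsGoodDisk.center_mem (h : IsSeparatedFamily x r) (hl : 0 < l) {i : ι} {e : C(Disk, S2)}
    (he : IsGoodDisk x r l i e) : x i ∈ diskInterior e :=
  he.ball_subset (mem_ball_self (by have := h.pos i; positivity))

/-- Of two disks, the one of smaller weight is contained in the interior of the other or disjoint
from it, since it is contained in a ball that does not meet the boundary of the other. -/
lemma IsGoodDisk.subset_or_disjoint (h : IsSeparatedFamily x r) (hl : 0 < l) (hl1 : l ≤ 1 / 1000)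
    {i j : ι} {e e' : C(Disk, S2)} (he : IsGoodDisk x r l i e) (he' : IsGoodDisk x r l j e')
    (hij : j ≠ i) (hr : r j ≤ r i) : range e' ⊆ diskInterior e ∨ Disjoint (range e') (range e) := by
  have hB : IsPreconnected (ball (x j) (3 * l * r j / 4)) := by
    apply isPreconnected_ball_sphere
    have := h.pos j
    have := h.le_one j
    nlinarith
  have hcl : IsClosed (range e) := (isCompact_range e.continuous).isClosed
  have hcov : ball (x j) (3 * l * r j / 4) ⊆ diskInterior e ∪ (range e)ᶜ := by
    intro y hy
    by_cases hye : y ∈ range e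
    · rw [← diskInterior_union_diskBoundary] at hye
      exact Or.inl (hye.resolve_right fun hb => (disjoint_left.1 (he.disjoint j hij hr)) hb hy)
    · exact Or.inr hye
  have hdisj : diskInterior e ∩ (range e)ᶜ = ∅ := by
    rw [← disjoint_iff_inter_eq_empty, disjoint_compl_right_iff_subset]
    exact image_subset_range _ _
  rcases isPreconnected_iff_subset_of_disjoint.1 hB _ _ he.isOpen hcl.isOpen_compl hcov
    (by rw [hdisj, inter_empty]) with h1 | h1
  · exact Or.inl (he'.range_subset.trans h1)
  · exact Or.inr (disjoint_right.2 fun y hy hy' => h1 (he'.range_subset hy') hy)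

/-- The Sierpinski curve is the complement of the union of the maximal disks. -/
theorem IsSeparatedFamily.exists_isSierpinskiCurve (h : IsSeparatedFamily x r) (hl : 0 < l)
    (hl1 : l ≤ 1 / 1000) :
    ∃ (S : Set S2) (C : Set (Set S2)), IsSierpinskiCurve S C ∧
      (⋃ i, ball (x i) (l * r i))ᶜ ⊆ S ∧ S ⊆ (⋃ i, ball (x i) (l / 4 * r i))ᶜ ∧
      ∀ γ ∈ C, ∃ i, γ ⊆ ball (x i) (3 * l * r i / 4) := by
  choose e he using h.exists_isGoodDisk hl hl1
  have hint : ∀ i, diskInterior (e i) ⊆ range (e i) := fun i => image_subset_range _ _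
  have hcen : ∀ i, x i ∈ diskInterior (e i) := fun i => (he i).center_mem h hl
  have hcl : ∀ i, IsClosed (range (e i)) := fun i => (isCompact_range (e i).continuous).isClosed
  have hbdne : ∀ i, (diskBoundary (e i)).Nonempty := fun i =>
    ⟨e i (circleToDisk 1), _, by
      have : circleToDisk 1 ∈ range circleToDisk := mem_range_self _
      rwa [range_circleToDisk] at this, rfl⟩
  -- A closed disk is never contained in its own interior.
  have hirr : ∀ i, ¬ range (e i) ⊆ diskInterior (e i) := fun i hsub => by
    obtain ⟨y, hy⟩ := hbdne i
    have hy' : y ∈ range (e i) := by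
      rw [← diskInterior_union_diskBoundary]; exact Or.inr hy
    exact disjoint_left.1 (disjoint_diskInterior_diskBoundary (he i).isEmbedding) (hsub hy') hy
  have hlt : ∀ i j, range (e i) ⊆ diskInterior (e j) → r i < r j := fun i j hij => by
    by_contra! hle
    have hne : j ≠ i := by rintro rfl; exact hirr _ hij
    rcases (he i).subset_or_disjoint h hl hl1 (he j) hne hle with h1 | h1
    · exact hirr i (hij.trans ((hint j).trans h1))
    · exact disjoint_left.1 h1 (hint j (hij (hint i (hcen i)))) (hint i (hcen i))
  let M : Set ι := {i | ∀ j, ¬ range (e i) ⊆ diskInterior (e j)}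
  have hMdisj : ∀ i ∈ M, ∀ j ∈ M, i ≠ j → Disjoint (range (e i)) (range (e j)) := by
    intro i hi j hj hij
    rcases le_total (r j) (r i) with hr | hr
    · rcases (he i).subset_or_disjoint h hl hl1 (he j) hij.symm hr with h1 | h1
      exacts [absurd h1 (hj i), h1.symm]
    · rcases (he j).subset_or_disjoint h hl hl1 (he i) hij hr with h1 | h1
      exacts [absurd h1 (hi j), h1]
  have hmax : ∀ i, ∃ j ∈ M, diskInterior (e i) ⊆ diskInterior (e j) := by
    intro i
    have hf : {j | j = i ∨ range (e i) ⊆ diskInterior (e j)}.Finite := by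
      refine (finite_setOf_le_of_sep h.sep (h.pos i)).subset ?_
      rintro j (rfl | hj)
      exacts [le_refl (r j), (hlt _ _ hj).le]
    obtain ⟨j, hj, hjmax⟩ := hf.exists_maximalFor r _ ⟨i, Or.inl rfl⟩
    refine ⟨j, fun k hk => ?_, ?_⟩
    · have hk' : range (e i) ⊆ diskInterior (e k) := by
        rcases hj with rfl | hj
        exacts [hk, hj.trans ((hint j).trans hk)]
      exact absurd (hjmax (Or.inr hk') (hlt _ _ hk).le) (not_le.2 (hlt _ _ hk))
    · rcases hj with rfl | hj
      exacts [subset_rfl, (hint i).trans hj]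
  have hxM : range x ⊆ ⋃ i ∈ M, diskInterior (e i) := by
    rintro _ ⟨i, rfl⟩
    obtain ⟨j, hj, hij⟩ := hmax i
    exact mem_biUnion hj (hij (hcen i))
  have hMinf : M.Infinite := by
    intro hfin
    -- Otherwise finitely many disjoint closed disks cover the sphere, which is connected.
    have huniv : (⋃ i ∈ M, range (e i)) = univ := by
      have hc : IsClosed (⋃ i ∈ M, range (e i)) := hfin.isClosed_biUnion fun i _ => hcl i
      rw [← hc.closure_eq]
      exact (h.dense.mono (hxM.trans (iUnion₂_mono fun i _ => hint i))).closure_eq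
    obtain ⟨i, hi, -⟩ : ∃ i ∈ M, True := by
      obtain ⟨i, hi, -⟩ := hmax h.dense.nonempty.some
      exact ⟨i, hi, trivial⟩
    have hcompl : (range (e i))ᶜ = ⋃ j ∈ M \ {i}, range (e j) := by
      ext y
      constructor
      · intro hy
        have hyu : y ∈ ⋃ i ∈ M, range (e i) := by rw [huniv]; trivial
        obtain ⟨j, hj, hyj⟩ := mem_iUnion₂.1 hyu
        refine mem_iUnion₂.2 ⟨j, ⟨hj, ?_⟩, hyj⟩
        rintro rfl
        exact hy hyj
      · intro hy hyi
        obtain ⟨j, hj, hyj⟩ := mem_iUnion₂.1 hy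
        exact disjoint_left.1 (hMdisj j hj.1 i hi hj.2) hyj hyi
    have hclopen : IsClopen (range (e i)) := by
      refine ⟨hcl i, ?_⟩
      rw [← isClosed_compl_iff, hcompl]
      exact (hfin.subset sdiff_subset).isClosed_biUnion fun j _ => hcl j
    have hne : (range (e i)).Nonempty := ⟨_, hint i (hcen i)⟩
    have hall := hclopen.eq_univ hne
    have hneg : - x i ∈ ball (x i) (3 * l * r i / 4) := (he i).range_subset (by rw [hall]; trivial)
    rw [mem_ball, dist_neg_self] at hneg
    have := h.pos i
    have := h.le_one i
    nlinarith
  have : Countable ι := countable_of_sep h.pos h.sep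
  have : Infinite M := hMinf.to_subtype
  obtain ⟨s⟩ : Nonempty (ℕ ≃ M) := nonempty_equiv_of_countable
  have hU : (⋃ n, diskInterior (e (s n))) = ⋃ i ∈ M, diskInterior (e i) := by
    rw [biUnion_eq_iUnion]
    exact s.surjective.iUnion_comp fun i : M => diskInterior (e i)
  refine ⟨(⋃ n, diskInterior (e (s n)))ᶜ, range fun n => diskBoundary (e (s n)),
    ⟨fun n => e (s n), fun n => (he _).isEmbedding, fun m n hmn => ?_, ?_, ?_, rfl, rfl⟩, ?_, ?_, ?_⟩
  · rw [closure_diskInterior, closure_diskInterior]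
    exact hMdisj _ (s m).2 _ (s n).2 fun heq => hmn (s.injective (Subtype.ext heq))
  · have hr0 : Tendsto (fun n => r (s n)) atTop (𝓝 0) := by
      rw [← Nat.cofinite_eq_atTop]
      refine (Metric.nhds_basis_ball.tendsto_right_iff).2 fun ε hε => ?_
      rw [eventually_cofinite]
      have hf := (finite_setOf_le_of_sep h.sep hε).preimage
        (f := fun n : ℕ => (s n : ι)) (Subtype.val_injective.comp s.injective).injOn
      refine hf.subset fun n hn => ?_
      simp only [mem_ofPred_eq, mem_ball, Real.dist_eq, sub_zero, abs_of_pos (h.pos _), not_lt] at hn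
      exact hn
    refine squeeze_zero (fun _ => diam_nonneg) (fun n => ?_)
      (by simpa using hr0.const_mul (2 * l))
    have h1 : diam (diskInterior (e (s n))) ≤ diam (ball (x (s n)) (3 * l * r (s n) / 4)) :=
      diam_mono ((hint _).trans (he _).range_subset) isBounded_ball
    have hp := h.pos (s n)
    have h2 := diam_ball (x := x (s n)) (r := 3 * l * r (s n) / 4) (by positivity)
    have : 0 < l * r (s n) := by positivity
    linarith
  · refine h.dense.mono (hxM.trans ?_)
    rw [← hU]
    exact iUnion_mono fun n => subset_closure
  · rw [compl_subset_compl]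
    refine iUnion_subset fun n => ?_
    refine ((hint _).trans (he _).range_subset).trans ?_
    refine (ball_subset_ball ?_).trans (subset_iUnion (fun i => ball (x i) (l * r i)) _)
    have := h.pos (s n)
    have : 0 < l * r (s n) := by positivity
    linarith
  · rw [compl_subset_compl, hU]
    refine iUnion_subset fun i => (he i).ball_subset.trans ?_
    obtain ⟨j, hj, hij⟩ := hmax i
    exact hij.trans (subset_biUnion_of_mem (u := fun j => diskInterior (e j)) hj)
  · rintro _ ⟨n, rfl⟩
    refine ⟨s n, ?_⟩
    refine Subset.trans ?_ (he (s n)).range_subset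
    exact image_subset_range _ _

end

/-! ### Disjoint horoballs -/

section

lemma lorentz_comm (x y : Mink) : lorentz x y = lorentz y x := by
  simp only [lorentz, real_inner_comm, mul_comm]

lemma lorentz_add_left (x y z : Mink) : lorentz (x + y) z = lorentz x z + lorentz y z := by
  simp only [lorentz, Prod.fst_add, Prod.snd_add, inner_add_left]; ring

lemma lorentz_smul_left (a : ℝ) (x z : Mink) : lorentz (a • x) z = a * lorentz x z := by
  simp only [lorentz, Prod.smul_fst, Prod.smul_snd, inner_smul_left, smul_eq_mul, conj_trivial]
  ring

lemma lorentz_add_right (x y z : Mink) : lorentz x (y + z) = lorentz x y + lorentz x z := by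
  simp only [lorentz, Prod.fst_add, Prod.snd_add, inner_add_right]; ring

lemma lorentz_smul_right (a : ℝ) (x z : Mink) : lorentz x (a • z) = a * lorentz x z := by
  simp only [lorentz, Prod.smul_fst, Prod.smul_snd, inner_smul_right, smul_eq_mul]
  ring

@[simp] lemma norm_coe_S2 (p : S2) : ‖(p : E3)‖ = 1 := by simp

lemma lorentz_nullVec_nullVec (p q : S2) :
    lorentz (nullVec p) (nullVec q) = - dist p q ^ 2 / 2 := by
  rw [Subtype.dist_eq, dist_eq_norm, norm_sub_sq_real, norm_coe_S2, norm_coe_S2]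
  simp only [lorentz, nullVec]
  ring

lemma sq_fst_of_mem_H3 {x : Mink} (hx : x ∈ H3) : x.1 ^ 2 = 1 + ‖x.2‖ ^ 2 := by
  have := hx.1
  simp only [lorentz, real_inner_self_eq_norm_sq] at this
  linarith

lemma norm_snd_lt_of_mem_H3 {x : Mink} (hx : x ∈ H3) : ‖x.2‖ < x.1 := by
  have h1 := sq_fst_of_mem_H3 hx
  have h2 := hx.2
  nlinarith [norm_nonneg x.2]

lemma one_le_fst_of_mem_H3 {x : Mink} (hx : x ∈ H3) : 1 ≤ x.1 := by
  have h1 := sq_fst_of_mem_H3 hx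
  have h2 := hx.2
  nlinarith [sq_nonneg ‖x.2‖]

lemma neg_lorentz_nullVec (x : Mink) (p : S2) :
    -lorentz x (nullVec p) = x.1 - inner ℝ x.2 (p : E3) := by
  simp [lorentz, nullVec]

lemma fst_sub_norm_le (x : Mink) (p : S2) : x.1 - ‖x.2‖ ≤ -lorentz x (nullVec p) := by
  rw [neg_lorentz_nullVec]
  have := real_inner_le_norm x.2 (p : E3)
  rw [norm_coe_S2, mul_one] at this
  linarith

lemma neg_lorentz_nullVec_pos {x : Mink} (hx : x ∈ H3) (p : S2) : 0 < -lorentz x (nullVec p) := by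
  have := fst_sub_norm_le x p
  have := norm_snd_lt_of_mem_H3 hx
  linarith

lemma isClosed_H3 : IsClosed H3 := by
  have : H3 = {x | lorentz x x = -1} ∩ {x | 0 ≤ x.1} := by
    ext x
    refine ⟨fun h => ⟨h.1, h.2.le⟩, fun h => ⟨h.1, lt_of_le_of_ne h.2 fun e => ?_⟩⟩
    have h1 := h.1
    simp only [mem_ofPred_eq, lorentz, ← e, real_inner_self_eq_norm_sq] at h1
    nlinarith [sq_nonneg ‖x.2‖]
  rw [this]
  refine (isClosed_eq ?_ continuous_const).inter (isClosed_le continuous_const continuous_fst)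
  unfold lorentz
  fun_prop

/-- A point of the geodesic that joins two boundary points. -/
lemma add_mem_H3 {p q : S2} {a b : ℝ} (ha : 0 < a) (hb : 0 < b) (hab : a * b * dist p q ^ 2 = 1) :
    a • nullVec p + b • nullVec q ∈ H3 ∧
      -lorentz (a • nullVec p + b • nullVec q) (nullVec p) = b * dist p q ^ 2 / 2 ∧
      -lorentz (a • nullVec p + b • nullVec q) (nullVec q) = a * dist p q ^ 2 / 2 := by
  simp only [lorentz_add_left, lorentz_add_right, lorentz_smul_left, lorentz_smul_right,
    lorentz_nullVec_nullVec, dist_self, dist_comm q p, H3, mem_ofPred_eq]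
  refine ⟨⟨by linarith, ?_⟩, by ring, by ring⟩
  simp [nullVec]
  positivity

lemma exists_mem_H3_neg_lorentz_eq (p : S2) {s : ℝ} (hs : 0 < s) :
    ∃ x ∈ H3, -lorentz x (nullVec p) = s := by
  have hd : dist p (-p) ^ 2 = 4 := by rw [dist_comm, dist_neg_self]; norm_num
  obtain ⟨h1, h2, -⟩ := add_mem_H3 (p := p) (q := -p) (a := 1 / (2 * s)) (b := s / 2)
    (by positivity) (by positivity) (by rw [hd]; field_simp; ring)
  exact ⟨_, h1, by rw [h2, hd]; ring⟩

/-- Disjoint horoballs have base points that are far apart. -/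
lemma four_mul_le_dist_sq {p q : S2} (hpq : p ≠ q) {s t : ℝ} (hs : 0 < s)
    (h : Disjoint {x | x ∈ H3 ∧ -lorentz x (nullVec p) < s}
      {x | x ∈ H3 ∧ -lorentz x (nullVec q) < t}) : 4 * (s * t) ≤ dist p q ^ 2 := by
  by_contra! hlt
  have hD : 0 < dist p q ^ 2 := by have := dist_pos.2 hpq; positivity
  have hD' : dist p q ≠ 0 := (dist_pos.2 hpq).ne'
  obtain ⟨a, ha1, ha2⟩ : ∃ a, 1 / (2 * s) < a ∧ a < 2 * t / dist p q ^ 2 := by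
    apply exists_between
    rw [div_lt_div_iff₀ (by positivity) hD]
    linarith
  have ha : 0 < a := lt_trans (by positivity) ha1
  obtain ⟨h1, h2, h3⟩ := add_mem_H3 (p := p) (q := q) (a := a) (b := 1 / (a * dist p q ^ 2))
    ha (by positivity) (by field_simp)
  refine disjoint_left.1 h ⟨h1, ?_⟩ ⟨h1, ?_⟩
  · rw [h2]
    rw [div_lt_iff₀ (by positivity)] at ha1
    have : 1 / (a * dist p q ^ 2) * dist p q ^ 2 / 2 = 1 / (2 * a) := by field_simp
    rw [this, div_lt_iff₀ (by positivity)]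
    linarith
  · rw [h3]
    rw [lt_div_iff₀ hD] at ha2
    linarith

lemma radius_pos (B : Set Mink) : 0 < radius B := Real.exp_pos _

lemma radius_le_one {B : Set Mink} (hB : B ⊆ H3) : radius B ≤ 1 := by
  rw [radius, Real.exp_le_one_iff, neg_nonpos]
  refine Real.sInf_nonneg ?_
  rintro _ ⟨x, hx, rfl⟩
  apply Real.arcosh_nonneg
  have := one_le_fst_of_mem_H3 (hB hx)
  simpa [lorentz, basePoint] using this

/-- Equality holds for `t ≤ 1`; for larger `t` the horoball contains the base point. -/
lemma radius_le (p : S2) {t : ℝ} (ht : 0 < t) :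
    radius {x | x ∈ H3 ∧ -lorentz x (nullVec p) < t} ≤ t := by
  rw [radius, ← Real.le_log_iff_exp_le ht, neg_le]
  refine le_csInf ?_ ?_
  · obtain ⟨x, hx, hxt⟩ := exists_mem_H3_neg_lorentz_eq p (half_pos ht)
    exact ⟨_, mem_image_of_mem _ ⟨hx, by rw [hxt]; linarith⟩⟩
  · rintro _ ⟨x, ⟨hx, hxt⟩, rfl⟩
    have h1 : -lorentz basePoint x = x.1 := by simp [lorentz, basePoint]
    have h0 := one_le_fst_of_mem_H3 hx
    rw [hdist, h1, neg_le, Real.le_log_iff_exp_le ht, Real.exp_neg, Real.exp_arcosh h0]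
    have h2 : Real.sqrt (x.1 ^ 2 - 1) = ‖x.2‖ := by
      rw [sq_fst_of_mem_H3 hx, add_sub_cancel_left, Real.sqrt_sq (norm_nonneg _)]
    rw [h2]
    have h3 : (x.1 + ‖x.2‖)⁻¹ = x.1 - ‖x.2‖ := by
      have h4 := sq_fst_of_mem_H3 hx
      have : 0 < x.1 + ‖x.2‖ := by positivity
      rw [inv_eq_one_div, div_eq_iff this.ne']
      linarith
    rw [h3]
    exact (fst_sub_norm_le x p).trans hxt.le

/-! ### Isometries and their action on the boundary -/

lemma lorentz_map {g : Mink ≃ₗ[ℝ] Mink} (hg : g ∈ isomH3) (x y : Mink) :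
    lorentz (g x) (g y) = lorentz x y := hg.1 x y

lemma map_mem_H3 {g : Mink ≃ₗ[ℝ] Mink} (hg : g ∈ isomH3) {x : Mink} (hx : x ∈ H3) : g x ∈ H3 := by
  rw [← hg.2]
  exact mem_image_of_mem _ hx

lemma exists_boundaryMaps {g : Mink ≃ₗ[ℝ] Mink} (hg : g ∈ isomH3) (p : S2) :
    ∃ q, BoundaryMaps g p q := by
  set y := g (nullVec p) with hy
  have h0 : lorentz y y = 0 := by
    rw [hy, lorentz_map hg, lorentz_nullVec_nullVec, dist_self]; norm_num
  simp only [lorentz, real_inner_self_eq_norm_sq] at h0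
  have hy1 : 0 < y.1 := by
    by_contra! hle
    obtain ⟨x, hx, hxp⟩ := exists_mem_H3_neg_lorentz_eq p one_pos
    have hgx := norm_snd_lt_of_mem_H3 (map_mem_H3 hg hx)
    rw [← lorentz_map hg, ← hy] at hxp
    simp only [lorentz] at hxp
    have h1 := neg_le_of_abs_le (abs_real_inner_le_norm (g x).2 y.2)
    have h2 : ‖y.2‖ = -y.1 := by
      rw [← abs_of_nonneg (norm_nonneg y.2), ← abs_of_nonpos hle, ← sq_eq_sq_iff_abs_eq_abs]
      linarith
    rw [h2] at h1
    nlinarith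
  have h2 : ‖y.2‖ = y.1 := by
    rw [← abs_of_nonneg (norm_nonneg y.2), ← abs_of_pos hy1, ← sq_eq_sq_iff_abs_eq_abs]
    linarith
  refine ⟨⟨y.1⁻¹ • y.2, ?_⟩, y.1, hy1, ?_⟩
  · rw [mem_sphere_zero_iff_norm, norm_smul, norm_inv, Real.norm_of_nonneg hy1.le, h2,
      inv_mul_cancel₀ hy1.ne']
  · rw [← hy]
    ext1
    · simp [nullVec]
    · simp [nullVec, hy1.ne']

lemma BoundaryMaps.unique {g : Mink ≃ₗ[ℝ] Mink} {p q q' : S2} (h : BoundaryMaps g p q)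
    (h' : BoundaryMaps g p q') : q = q' := by
  obtain ⟨c, hc, h⟩ := h
  obtain ⟨c', hc', h'⟩ := h'
  rw [h] at h'
  have h1 := congrArg Prod.fst h'
  have h2 := congrArg Prod.snd h'
  simp only [nullVec, Prod.smul_fst, Prod.smul_snd, smul_eq_mul, mul_one] at h1 h2
  rw [← h1] at h2
  exact Subtype.ext (smul_right_injective _ hc.ne' h2)

lemma BoundaryMaps.mul {g h : Mink ≃ₗ[ℝ] Mink} {p q s : S2} (hg : BoundaryMaps g q s)
    (hh : BoundaryMaps h p q) : BoundaryMaps (g * h) p s := by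
  obtain ⟨c, hc, hg⟩ := hg
  obtain ⟨d, hd, hh⟩ := hh
  refine ⟨d * c, by positivity, ?_⟩
  rw [LinearEquiv.mul_apply, hh, map_smul, hg, smul_smul]

lemma BoundaryMaps.inv {g : Mink ≃ₗ[ℝ] Mink} {p q : S2} (hg : BoundaryMaps g p q) :
    BoundaryMaps g⁻¹ q p := by
  obtain ⟨c, hc, hg⟩ := hg
  refine ⟨c⁻¹, by positivity, ?_⟩
  have : g⁻¹ (g (nullVec p)) = nullVec p := g.symm_apply_apply _
  rw [hg, map_smul] at this
  rw [← this, smul_smul, inv_mul_cancel₀ hc.ne', one_smul]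

variable {G : Subgroup (Mink ≃ₗ[ℝ] Mink)}

/-- Parabolic points are mapped to parabolic points. -/
lemma BoundaryMaps.mem_parabolicPoints (hG : G ≤ isomH3) {g : Mink ≃ₗ[ℝ] Mink} (hg : g ∈ G)
    {p q : S2} (hp : p ∈ parabolicPoints G) (hpq : BoundaryMaps g p q) :
    q ∈ parabolicPoints G := by
  obtain ⟨h, hh, ⟨hhi, hfix, huniq⟩, hhp⟩ := hp
  have hfixq : BoundaryMaps (g * h * g⁻¹) q q := (hpq.mul hhp).mul hpq.inv
  refine ⟨g * h * g⁻¹, G.mul_mem (G.mul_mem hg hh) (G.inv_mem hg), ⟨?_, ?_, q, hfixq, ?_⟩, hfixq⟩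
  · exact isomH3.mul_mem (isomH3.mul_mem (hG hg) hhi) (isomH3.inv_mem (hG hg))
  · intro x hx hgx
    refine hfix (g⁻¹ x) (map_mem_H3 (isomH3.inv_mem (hG hg)) hx) ?_
    have : g⁻¹ (g (h (g⁻¹ x))) = h (g⁻¹ x) := g.symm_apply_apply _
    rw [← this]
    exact congrArg _ hgx
  · intro q' hq'
    obtain ⟨p', hp'⟩ := exists_boundaryMaps (isomH3.inv_mem (hG hg)) q'
    have h1 : BoundaryMaps h p' p' := by
      have := (hp'.mul hq').mul hp'.inv
      simpa [mul_assoc] using this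
    have h2 : p' = p := huniq.unique h1 hhp
    rw [h2] at hp'
    have := hp'.inv
    rw [inv_inv] at this
    exact this.unique hpq

/-- The data of a `G`-equivariant family of disjoint horoballs: the horoball at `p` consists of the
points `x` with `-⟨x, nullVec p⟩ < t p`. -/
structure IsThreshold (H : parabolicPoints G → Set Mink) (t : parabolicPoints G → ℝ) : Prop where
  pos : ∀ p, 0 < t p
  eq : ∀ p, H p = {x | x ∈ H3 ∧ -lorentz x (nullVec p) < t p}

lemma IsHoroballFamily.exists_isThreshold {H : parabolicPoints G → Set Mink}
    (hH : IsHoroballFamily G H) : ∃ t, IsThreshold H t := by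
  choose t ht hHt using hH.horoball
  exact ⟨t, ht, hHt⟩

variable {H : parabolicPoints G → Set Mink} {t : parabolicPoints G → ℝ}

lemma IsThreshold.sep (ht : IsThreshold H t) (hH : IsHoroballFamily G H)
    (p q : parabolicPoints G) (hpq : p ≠ q) :
    2 * Real.sqrt (t p * t q) ≤ dist (p : S2) (q : S2) := by
  have h := hH.disjoint p q hpq
  rw [ht.eq, ht.eq] at h
  have h4 := four_mul_le_dist_sq (fun e => hpq (Subtype.ext e)) (ht.pos p) h
  have hp := ht.pos p
  have hq := ht.pos q
  apply le_of_sq_le_sq _ dist_nonneg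
  rw [mul_pow, Real.sq_sqrt (by positivity)]
  linarith

lemma IsThreshold.radius_le (ht : IsThreshold H t) (p : parabolicPoints G) :
    radius (H p) ≤ t p := by
  rw [ht.eq]
  exact CuspedHyperbolic.radius_le _ (ht.pos p)

lemma IsThreshold.radius_le_one (ht : IsThreshold H t) (p : parabolicPoints G) :
    radius (H p) ≤ 1 := by
  rw [ht.eq]
  exact CuspedHyperbolic.radius_le_one fun x hx => hx.1

/-- The group permutes the null vectors `(t p)⁻¹ • nullVec p`. -/
lemma IsThreshold.map_smul_nullVec (ht : IsThreshold H t) (hH : IsHoroballFamily G H)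
    (hG : G ≤ isomH3) {g : Mink ≃ₗ[ℝ] Mink} (hg : g ∈ G) (p : parabolicPoints G) :
    ∃ q : parabolicPoints G, g ((t p)⁻¹ • nullVec p) = (t q)⁻¹ • nullVec q := by
  obtain ⟨q, hq⟩ := exists_boundaryMaps (hG hg) p
  have hqP := hq.mem_parabolicPoints hG hg p.2
  refine ⟨⟨q, hqP⟩, ?_⟩
  have himg := hH.equivariant g hg p ⟨q, hqP⟩ hq
  obtain ⟨c, hc, hcq⟩ := hq
  set q' : parabolicPoints G := ⟨q, hqP⟩
  have hiff : ∀ s, 0 < s → (s < t q' ↔ c * s < t p) := by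
    intro s hs
    obtain ⟨y, hy, hys⟩ := exists_mem_H3_neg_lorentz_eq q hs
    obtain ⟨x, hx, rfl⟩ : y ∈ (fun x => g x) '' H3 := by rw [(hG hg).2]; exact hy
    have h1 : -lorentz x (nullVec p) = c * s := by
      rw [← lorentz_map (hG hg), hcq, lorentz_smul_right, ← hys]; ring
    have h2 : g x ∈ H q' ↔ x ∈ H p := by
      rw [← himg]
      exact g.injective.mem_set_image
    rw [ht.eq, ht.eq] at h2
    simp only [mem_ofPred_eq, hx, hy, true_and, h1] at h2
    rw [← h2, ← hys]
  have hteq : t p = c * t q' := by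
    have h1 := ht.pos p
    have h2 := ht.pos q'
    apply le_antisymm
    · by_contra! hlt
      exact lt_irrefl _ ((hiff _ h2).2 hlt)
    · by_contra! hlt
      have := (hiff (t p / c) (by positivity)).1 (by rw [div_lt_iff₀ hc]; linarith)
      rw [mul_div_cancel₀ _ hc.ne'] at this
      exact lt_irrefl _ this
  rw [map_smul, hcq, smul_smul, hteq]
  congr 1
  field_simp

end

/-! ### Invariance of the hyperbolic volume -/

section

/-- The Lorentz form as a bilinear form. -/
def lorentzForm : LinearMap.BilinForm ℝ Mink :=
  LinearMap.mk₂ ℝ lorentz lorentz_add_left lorentz_smul_left lorentz_add_right lorentz_smul_right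

@[simp] lemma lorentzForm_apply (x y : Mink) : lorentzForm x y = lorentz x y := rfl

lemma nondegenerate_lorentzForm : lorentzForm.Nondegenerate := by
  refine LinearMap.BilinForm.Nondegenerate.ofSeparatingLeft fun x hx => ?_
  -- Pair `x` with its time reflection.
  have h := hx (-x.1, x.2)
  simp only [lorentzForm_apply, lorentz, real_inner_self_eq_norm_sq] at h
  have h1 : x.1 = 0 := by nlinarith [sq_nonneg ‖x.2‖]
  have h2 : ‖x.2‖ = 0 := by nlinarith [sq_nonneg ‖x.2‖]
  exact Prod.ext h1 (norm_eq_zero.1 h2)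

lemma abs_det_of_mem_isomH3 {g : Mink ≃ₗ[ℝ] Mink} (hg : g ∈ isomH3) :
    |LinearMap.det (g : Mink →ₗ[ℝ] Mink)| = 1 := by
  classical
  let b := Module.finBasis ℝ Mink
  have hcomp : lorentzForm.comp (g : Mink →ₗ[ℝ] Mink) (g : Mink →ₗ[ℝ] Mink) = lorentzForm := by
    ext x y <;> simp [lorentz_map hg]
  have h := LinearMap.BilinForm.toMatrix_comp b b lorentzForm (g : Mink →ₗ[ℝ] Mink)
    (g : Mink →ₗ[ℝ] Mink)
  rw [hcomp] at h
  have hdet := congrArg Matrix.det h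
  rw [Matrix.det_mul, Matrix.det_mul, Matrix.det_transpose, LinearMap.det_toMatrix] at hdet
  have hne := (LinearMap.BilinForm.nondegenerate_iff_det_ne_zero b).1 nondegenerate_lorentzForm
  set d := LinearMap.det (g : Mink →ₗ[ℝ] Mink)
  have h1 : (LinearMap.BilinForm.toMatrix b lorentzForm).det * (d ^ 2 - 1) = 0 := by linarith
  have h2 := (mul_eq_zero.1 h1).resolve_left hne
  rw [← sq_eq_sq₀ (abs_nonneg _) zero_le_one, sq_abs]
  linarith

lemma volume_preimage_of_mem_isomH3 {g : Mink ≃ₗ[ℝ] Mink} (hg : g ∈ isomH3) (s : Set Mink) :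
    volume ((fun x => g x) ⁻¹' s) = volume s := by
  have hd := abs_det_of_mem_isomH3 hg
  have hne : LinearMap.det (g : Mink →ₗ[ℝ] Mink) ≠ 0 := fun h => by simp [h] at hd
  have : (volume : Measure Mink).IsAddHaarMeasure :=
    inferInstanceAs ((volume : Measure ℝ).prod (volume : Measure E3)).IsAddHaarMeasure
  have := Measure.addHaar_preimage_linearMap (volume : Measure Mink) hne s
  rw [abs_inv, hd] at this
  simpa using this

/-- The parametrization of `H3` by its spatial coordinate. -/
def hypParam (v : E3) : Mink := (Real.sqrt (1 + ‖v‖ ^ 2), v)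

lemma continuous_hypParam : Continuous hypParam := by
  unfold hypParam; fun_prop

lemma hypParam_mem (v : E3) : hypParam v ∈ H3 := by
  refine ⟨?_, by simp only [hypParam]; positivity⟩
  simp only [hypParam, lorentz, real_inner_self_eq_norm_sq]
  rw [Real.mul_self_sqrt (by positivity)]
  ring

lemma hypVolume_apply {A : Set Mink} (hA : MeasurableSet A) :
    hypVolume A = ∫⁻ v in hypParam ⁻¹' A, ENNReal.ofReal (1 / Real.sqrt (1 + ‖v‖ ^ 2)) := by
  have h : hypVolume = Measure.map hypParam ((volume : Measure E3).withDensity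
    fun v => ENNReal.ofReal (1 / Real.sqrt (1 + ‖v‖ ^ 2))) := rfl
  rw [h, Measure.map_apply continuous_hypParam.measurable hA,
    withDensity_apply _ (continuous_hypParam.measurable hA)]

/-- The part of the cone over `A ∩ H3` with proper time less than `1`. -/
def shortCone (A : Set Mink) : Set Mink :=
  {x | -1 < lorentz x x ∧ lorentz x x < 0 ∧ (Real.sqrt (-lorentz x x))⁻¹ • x ∈ A ∩ H3}

lemma continuous_lorentz_self : Continuous fun x : Mink => lorentz x x := by
  unfold lorentz; fun_prop

lemma measurableSet_shortCone {A : Set Mink} (hA : MeasurableSet A) :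
    MeasurableSet (shortCone A) := by
  have hL := continuous_lorentz_self.measurable
  refine (measurableSet_lt measurable_const hL).inter
    ((measurableSet_lt hL measurable_const).inter ?_)
  have h : Measurable fun x : Mink => (Real.sqrt (-lorentz x x))⁻¹ :=
    (continuous_lorentz_self.neg.sqrt).measurable.inv
  have h2 : Measurable fun x : Mink => (Real.sqrt (-lorentz x x))⁻¹ • x := h.smul measurable_id
  exact h2 (hA.inter isClosed_H3.measurableSet)

lemma preimage_shortCone {g : Mink ≃ₗ[ℝ] Mink} (hg : g ∈ isomH3) (A : Set Mink) :
    (fun x => g x) ⁻¹' shortCone A = shortCone ((fun x => g x) ⁻¹' A) := by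
  ext x
  have hH : ∀ y, g y ∈ H3 ↔ y ∈ H3 := fun y =>
    ⟨fun h => by
      have := map_mem_H3 (isomH3.inv_mem hg) h
      rwa [show g⁻¹ (g y) = y from g.symm_apply_apply y] at this, map_mem_H3 hg⟩
  simp only [shortCone, mem_preimage, mem_ofPred_eq, lorentz_map hg, mem_inter_iff, ← map_smul, hH]

/-- Membership in the short cone, in the coordinates proper time and space. -/
lemma mem_shortCone_iff {A : Set Mink} {s : ℝ} (hs : 0 < s) (v : E3) :
    ((Real.sqrt (s ^ 2 + ‖s • v‖ ^ 2), s • v) : Mink) ∈ shortCone A ↔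
      s < 1 ∧ hypParam v ∈ A := by
  have hx : ((Real.sqrt (s ^ 2 + ‖s • v‖ ^ 2), s • v) : Mink) = s • hypParam v := by
    ext1
    · simp only [hypParam, Prod.smul_fst, smul_eq_mul, norm_smul, Real.norm_of_nonneg hs.le]
      rw [show s ^ 2 + (s * ‖v‖) ^ 2 = s ^ 2 * (1 + ‖v‖ ^ 2) by ring,
        Real.sqrt_mul (by positivity), Real.sqrt_sq hs.le]
    · rfl
  have hl : lorentz (s • hypParam v) (s • hypParam v) = -s ^ 2 := by
    rw [lorentz_smul_left, lorentz_smul_right, (hypParam_mem v).1]; ring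
  rw [hx, shortCone, mem_ofPred_eq, hl, neg_neg, Real.sqrt_sq hs.le, smul_smul,
    inv_mul_cancel₀ hs.ne', one_smul]
  constructor
  · rintro ⟨h1, -, h2, -⟩
    exact ⟨by nlinarith, h2⟩
  · rintro ⟨h1, h2⟩
    exact ⟨by nlinarith, by nlinarith, h2, hypParam_mem v⟩

lemma norm_snd_lt_of_mem_shortCone {A : Set Mink} {x : Mink} (hx : x ∈ shortCone A) :
    ‖x.2‖ < x.1 := by
  obtain ⟨-, h2, -, h3⟩ := hx
  have hs : 0 < Real.sqrt (-lorentz x x) := Real.sqrt_pos.2 (by linarith)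
  have := norm_snd_lt_of_mem_H3 h3
  simp only [Prod.smul_fst, Prod.smul_snd, norm_smul, smul_eq_mul, norm_inv,
    Real.norm_of_nonneg hs.le] at this
  exact lt_of_mul_lt_mul_left this (by positivity)

/-- Integration over the times greater than `a`, with the proper time as coordinate. -/
lemma lintegral_Ioi_sqrt {a : ℝ} (ha : 0 ≤ a) (f : ℝ → ENNReal) :
    ∫⁻ τ in Ioi a, f τ = ∫⁻ s in Ioi 0, ENNReal.ofReal (s / Real.sqrt (s ^ 2 + a ^ 2)) *
      f (Real.sqrt (s ^ 2 + a ^ 2)) := by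
  have himg : (fun s : ℝ => Real.sqrt (s ^ 2 + a ^ 2)) '' Ioi 0 = Ioi a := by
    ext τ
    constructor
    · rintro ⟨s, hs, rfl⟩
      rw [mem_Ioi] at hs ⊢
      exact Real.lt_sqrt_of_sq_lt (by nlinarith)
    · intro hτ
      rw [mem_Ioi] at hτ
      have h : 0 < τ ^ 2 - a ^ 2 := by nlinarith
      refine ⟨Real.sqrt (τ ^ 2 - a ^ 2), Real.sqrt_pos.2 h, ?_⟩
      simp only
      rw [Real.sq_sqrt h.le, sub_add_cancel, Real.sqrt_sq (by linarith)]
  have hinj : InjOn (fun s : ℝ => Real.sqrt (s ^ 2 + a ^ 2)) (Ioi 0) := by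
    intro s hs t ht hst
    rw [mem_Ioi] at hs ht
    simp only at hst
    rw [Real.sqrt_inj (by positivity) (by positivity)] at hst
    exact (sq_eq_sq₀ hs.le ht.le).1 (by linarith)
  have hderiv : ∀ s ∈ Ioi (0 : ℝ), HasDerivWithinAt (fun s : ℝ => Real.sqrt (s ^ 2 + a ^ 2))
      (s / Real.sqrt (s ^ 2 + a ^ 2)) (Ioi 0) s := by
    intro s hs
    rw [mem_Ioi] at hs
    have h1 : HasDerivAt (fun s : ℝ => s ^ 2 + a ^ 2) (2 * s) s := by
      simpa using (hasDerivAt_pow 2 s).add_const (a ^ 2)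
    have h2 := h1.sqrt (by positivity)
    rw [mul_div_mul_left _ _ two_ne_zero] at h2
    exact h2.hasDerivWithinAt
  rw [← himg, lintegral_image_eq_lintegral_abs_deriv_mul measurableSet_Ioi hderiv hinj]
  refine setLIntegral_congr_fun measurableSet_Ioi fun s hs => ?_
  rw [mem_Ioi] at hs
  rw [abs_of_nonneg (by positivity)]

lemma lintegral_eq_smul_lintegral_comp_smul {s : ℝ} (hs : 0 < s) (f : E3 → ENNReal) :
    ∫⁻ w, f w = ENNReal.ofReal (s ^ 3) * ∫⁻ v, f (s • v) := by
  have h := Measure.map_addHaar_smul (volume : Measure E3) hs.ne'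
  have h2 : ∫⁻ v, f (s • v) = ∫⁻ w, f w ∂(Measure.map (s • ·) (volume : Measure E3)) :=
    ((Homeomorph.smulOfNeZero s hs.ne').toMeasurableEquiv.measurableEmbedding.lintegral_map f).symm
  rw [h2, h, lintegral_smul_measure, smul_eq_mul, ← mul_assoc, ← ENNReal.ofReal_mul (by positivity)]
  have : s ^ 3 * |(s ^ Module.finrank ℝ E3)⁻¹| = 1 := by
    rw [finrank_euclideanSpace_fin, abs_of_pos (by positivity)]
    field_simp
  rw [this, ENNReal.ofReal_one, one_mul]

/-- The density of Lebesgue measure on the short cone, in the coordinates space and proper time. -/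
def shortConeDensity (A : Set Mink) (w : E3) (s : ℝ) : ENNReal :=
  ENNReal.ofReal (s / Real.sqrt (s ^ 2 + ‖w‖ ^ 2)) *
    (shortCone A).indicator 1 (Real.sqrt (s ^ 2 + ‖w‖ ^ 2), w)

lemma measurable_shortConeDensity {A : Set Mink} (hA : MeasurableSet A) :
    Measurable (Function.uncurry (shortConeDensity A)) := by
  have h1 : Measurable fun z : E3 × ℝ => ENNReal.ofReal (z.2 / Real.sqrt (z.2 ^ 2 + ‖z.1‖ ^ 2)) :=
    (measurable_snd.div (by fun_prop)).ennreal_ofReal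
  have h2 : Continuous fun z : E3 × ℝ => ((Real.sqrt (z.2 ^ 2 + ‖z.1‖ ^ 2), z.1) : Mink) := by
    fun_prop
  have h3 : Measurable ((shortCone A).indicator (1 : Mink → ENNReal)) :=
    measurable_one.indicator (measurableSet_shortCone hA)
  exact h1.mul (h3.comp h2.measurable)

lemma shortConeDensity_smul (A : Set Mink) {s : ℝ} (hs : 0 < s) (v : E3) :
    shortConeDensity A (s • v) s = if s < 1 then (hypParam ⁻¹' A).indicator
      (fun v => ENNReal.ofReal (1 / Real.sqrt (1 + ‖v‖ ^ 2))) v else 0 := by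
  have hsq : Real.sqrt (s ^ 2 + ‖s • v‖ ^ 2) = s * Real.sqrt (1 + ‖v‖ ^ 2) := by
    rw [norm_smul, Real.norm_of_nonneg hs.le,
      show s ^ 2 + (s * ‖v‖) ^ 2 = s ^ 2 * (1 + ‖v‖ ^ 2) by ring,
      Real.sqrt_mul (by positivity), Real.sqrt_sq hs.le]
  rw [shortConeDensity]
  split_ifs with h1
  · by_cases hv : hypParam v ∈ A
    · rw [indicator_of_mem (show v ∈ hypParam ⁻¹' A from hv),
        indicator_of_mem ((mem_shortCone_iff hs v).2 ⟨h1, hv⟩), Pi.one_apply, mul_one, hsq,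
        div_mul_eq_div_div, div_self hs.ne']
    · rw [indicator_of_notMem (show v ∉ hypParam ⁻¹' A from hv), indicator_of_notMem
        (fun hmem => hv ((mem_shortCone_iff hs v).1 hmem).2), mul_zero]
  · rw [indicator_of_notMem (fun hmem => h1 ((mem_shortCone_iff hs v).1 hmem).1), mul_zero]

lemma lintegral_shortConeDensity {A : Set Mink} (hA : MeasurableSet A) {s : ℝ} (hs : 0 < s) :
    ∫⁻ w, shortConeDensity A w s =
      (Iio (1 : ℝ)).indicator (fun s => ENNReal.ofReal (s ^ 3)) s * hypVolume A := by
  rw [lintegral_eq_smul_lintegral_comp_smul hs]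
  simp only [shortConeDensity_smul A hs]
  split_ifs with h1
  · rw [indicator_of_mem (show s ∈ Iio (1 : ℝ) from h1), hypVolume_apply hA,
      ← lintegral_indicator (continuous_hypParam.measurable hA)]
  · rw [indicator_of_notMem (show s ∉ Iio (1 : ℝ) from h1)]
    simp

lemma volume_shortCone_eq_lintegral {A : Set Mink} (hA : MeasurableSet A) :
    volume (shortCone A) = ∫⁻ w, ∫⁻ s in Ioi (0 : ℝ), shortConeDensity A w s := by
  have hm := measurableSet_shortCone hA
  rw [← lintegral_indicator_one hm, Measure.volume_eq_prod,
    lintegral_prod_symm' _ (measurable_one.indicator hm)]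
  refine lintegral_congr fun w => ?_
  have h := lintegral_Ioi_sqrt (norm_nonneg w) fun τ => (shortCone A).indicator 1 (τ, w)
  refine Eq.trans ?_ h
  rw [← lintegral_indicator measurableSet_Ioi]
  refine lintegral_congr fun τ => ?_
  by_cases hτ : τ ∈ Ioi ‖w‖
  · rw [indicator_of_mem hτ]
  · have hmem : ((τ, w) : Mink) ∉ shortCone A := by
      intro hmem
      have h3 : ‖((τ, w) : Mink).2‖ < ((τ, w) : Mink).1 :=
        norm_snd_lt_of_mem_shortCone (A := A) (x := (τ, w)) hmem
      exact hτ h3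
    rw [indicator_of_notMem hτ, indicator_of_notMem hmem]

lemma volume_shortCone {A : Set Mink} (hA : MeasurableSet A) :
    volume (shortCone A) = (∫⁻ s in Ioo (0 : ℝ) 1, ENNReal.ofReal (s ^ 3)) * hypVolume A := by
  rw [volume_shortCone_eq_lintegral hA,
    lintegral_lintegral_swap (measurable_shortConeDensity hA).aemeasurable]
  have h : ∫⁻ s in Ioi (0 : ℝ), ∫⁻ w, shortConeDensity A w s = ∫⁻ s in Ioi (0 : ℝ),
      (Iio (1 : ℝ)).indicator (fun s => ENNReal.ofReal (s ^ 3)) s * hypVolume A :=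
    setLIntegral_congr_fun measurableSet_Ioi fun s hs => lintegral_shortConeDensity hA hs
  rw [h, lintegral_mul_const _ (Measurable.indicator (by fun_prop) measurableSet_Iio),
    setLIntegral_indicator measurableSet_Iio, inter_comm, Ioi_inter_Iio]

/-- The hyperbolic volume is invariant under isometries, since up to a constant the volume of a set
is the Lebesgue measure of a cone over it. -/
theorem hypVolume_preimage {g : Mink ≃ₗ[ℝ] Mink} (hg : g ∈ isomH3) {A : Set Mink}
    (hA : MeasurableSet A) : hypVolume ((fun x => g x) ⁻¹' A) = hypVolume A := by
  have hgm : Measurable fun x => g x := g.toContinuousLinearEquiv.continuous.measurable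
  have h := volume_preimage_of_mem_isomH3 hg (shortCone A)
  rw [preimage_shortCone hg, volume_shortCone hA, volume_shortCone (hgm hA)] at h
  refine (ENNReal.mul_right_inj ?_ ?_).1 h
  · refine (setLIntegral_pos_iff (by fun_prop)).2 ?_ |>.ne'
    have : Function.support (fun s : ℝ => ENNReal.ofReal (s ^ 3)) ∩ Ioo 0 1 = Ioo 0 1 := by
      refine inter_eq_right.2 fun s hs => ?_
      have := hs.1
      simp only [Function.mem_support]
      exact (ENNReal.ofReal_pos.2 (by positivity)).ne'
    rw [this]
    simp
  · refine ne_top_of_le_ne_top (b := ∫⁻ s in Ioo (0 : ℝ) 1, 1) (by simp) ?_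
    refine setLIntegral_mono' measurableSet_Ioo fun s hs => ?_
    exact ENNReal.ofReal_le_one.2 (pow_le_one₀ hs.1.le hs.2.le)

end

/-! ### Density of the parabolic points -/

section

open scoped Pointwise

variable {G : Subgroup (Mink ≃ₗ[ℝ] Mink)}

lemma isCompact_H3_inter_closedBall (M : ℝ) : IsCompact (H3 ∩ closedBall 0 M) :=
  (isCompact_closedBall _ _).inter_left isClosed_H3

lemma basePoint_mem_H3 : basePoint ∈ H3 := by
  simp [basePoint, H3, lorentz]

lemma IsCuspedFiniteVolumeGroup.countable (hG : IsCuspedFiniteVolumeGroup G) : Countable G := by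
  have h : (⋃ n : ℕ, {g : Mink ≃ₗ[ℝ] Mink | g ∈ G ∧ ((fun x => g x) '' (H3 ∩ closedBall 0 n) ∩
      (H3 ∩ closedBall 0 n)).Nonempty}).Countable :=
    countable_iUnion fun n => (hG.properlyDiscontinuous _ inter_subset_left
      (isCompact_H3_inter_closedBall _)).countable
  refine (h.mono fun g hg => ?_ : (G : Set (Mink ≃ₗ[ℝ] Mink)).Countable).to_subtype
  obtain ⟨n, hn⟩ := exists_nat_ge (max ‖basePoint‖ ‖g basePoint‖)
  rw [max_le_iff] at hn
  refine mem_iUnion.2 ⟨n, hg, g basePoint, ⟨basePoint, ⟨basePoint_mem_H3, ?_⟩, rfl⟩,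
    map_mem_H3 (hG.isometric hg) basePoint_mem_H3, ?_⟩
  · simpa using hn.1
  · simpa using hn.2

/-- A set that meets only finitely many of its translates has finite volume: its translates cover
a point of the fundamental domain a bounded number of times. -/
lemma IsCuspedFiniteVolumeGroup.hypVolume_lt_top (hG : IsCuspedFiniteVolumeGroup G)
    {A : Set Mink} (hA : MeasurableSet A) {S : Set (Mink ≃ₗ[ℝ] Mink)} (hS : S.Finite)
    (hSA : ∀ g ∈ G, ∀ x ∈ A, g x ∈ A → g ∈ S) : hypVolume A < ⊤ := by
  obtain ⟨F, hF, hFtop⟩ := hG.finiteVolume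
  have := hG.countable
  have hmeas : ∀ g : G, Measurable fun x : Mink => g • x := fun g =>
    (g : Mink ≃ₗ[ℝ] Mink).toContinuousLinearEquiv.continuous.measurable
  have : MeasurableConstSMul G Mink := ⟨hmeas⟩
  have : SMulInvariantMeasure G Mink hypVolume :=
    ⟨fun g s hs => hypVolume_preimage (hG.isometric g.2) hs⟩
  have hgA : ∀ g : G, MeasurableSet (g • A) := fun g => by
    rw [← preimage_smul_inv]
    exact hmeas _ hA
  have hcard : ∀ x, ∑' g : G, (g • A).indicator (1 : Mink → ENNReal) x ≤ hS.toFinset.card := by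
    intro x
    by_cases hne : ∃ g₀ : G, x ∈ g₀ • A
    swap
    · have : ∀ g : G, (g • A).indicator (1 : Mink → ENNReal) x = 0 := fun g =>
        indicator_of_notMem (fun h => hne ⟨g, h⟩) _
      simp [this]
    obtain ⟨g₀, hg₀⟩ := hne
    have hmap : ∀ g ∈ {g : G | x ∈ g • A}, ((g₀⁻¹ * g : G) : Mink ≃ₗ[ℝ] Mink) ∈ S := by
      intro g hg
      refine hSA _ (g₀⁻¹ * g).2 (g⁻¹ • x) (mem_smul_set_iff_inv_smul_mem.1 hg) ?_
      change (g₀⁻¹ * g) • (g⁻¹ • x) ∈ A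
      rw [mul_smul, smul_inv_smul]
      exact mem_smul_set_iff_inv_smul_mem.1 hg₀
    have hinj : InjOn (fun g : G => ((g₀⁻¹ * g : G) : Mink ≃ₗ[ℝ] Mink)) {g : G | x ∈ g • A} :=
      fun g _ h _ hgh => mul_left_cancel (Subtype.ext hgh)
    have hfin : {g : G | x ∈ g • A}.Finite := Set.Finite.of_injOn hmap hinj hS
    have hzero : ∀ g ∉ hfin.toFinset, (g • A).indicator (1 : Mink → ENNReal) x = 0 := fun g hg => by
      have h : x ∉ g • A := fun h => hg (hfin.mem_toFinset.2 h)
      exact indicator_of_notMem h _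
    rw [tsum_eq_sum hzero]
    calc ∑ g ∈ hfin.toFinset, (g • A).indicator (1 : Mink → ENNReal) x
        ≤ ∑ g ∈ hfin.toFinset, 1 := Finset.sum_le_sum fun g _ => indicator_le_self' (by simp) x
      _ = hfin.toFinset.card := by simp
      _ ≤ hS.toFinset.card := by
        have := Finset.card_le_card_of_injOn (s := hfin.toFinset) (t := hS.toFinset)
          (fun g : G => ((g₀⁻¹ * g : G) : Mink ≃ₗ[ℝ] Mink))
          (fun g hg => by simpa using hmap g (by simpa using hg)) (by simp)
        exact_mod_cast this
  calc hypVolume A = ∑' g : G, hypVolume (g • A ∩ F) := hF.measure_eq_tsum A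
    _ = ∑' g : G, ∫⁻ x in F, (g • A).indicator 1 x ∂hypVolume := by
      refine tsum_congr fun g => ?_
      rw [lintegral_indicator_one (hgA g), Measure.restrict_apply (hgA g)]
    _ = ∫⁻ x in F, ∑' g : G, (g • A).indicator 1 x ∂hypVolume :=
      (lintegral_tsum fun g => (measurable_one.indicator (hgA g)).aemeasurable).symm
    _ ≤ ∫⁻ _ in F, hS.toFinset.card ∂hypVolume := lintegral_mono hcard
    _ = hS.toFinset.card * hypVolume F := by rw [setLIntegral_const]
    _ < ⊤ := ENNReal.mul_lt_top (ENNReal.natCast_lt_top _) hFtop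

/-- The points of `H3` that are seen from the base point in a direction at distance less than `δ`
from `u`. -/
def visualCone (u : S2) (δ : ℝ) : Set Mink :=
  {x | x ∈ H3 ∧ ‖x.2 - ‖x.2‖ • (u : E3)‖ < δ * ‖x.2‖}

lemma measurableSet_visualCone (u : S2) (δ : ℝ) : MeasurableSet (visualCone u δ) := by
  have h : IsOpen {x : Mink | ‖x.2 - ‖x.2‖ • (u : E3)‖ < δ * ‖x.2‖} :=
    isOpen_lt (by fun_prop) (by fun_prop)
  exact isClosed_H3.measurableSet.inter h.measurableSet

/-- The density decays like `1 / |v|`, so dilating a bounded part of the cone by the factor `s`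
multiplies its volume by about `s ^ 2`. -/
lemma hypVolume_visualCone (u : S2) {δ : ℝ} (hδ : 0 < δ) : hypVolume (visualCone u δ) = ⊤ := by
  by_contra hne
  set V : Set E3 := hypParam ⁻¹' visualCone u δ with hV
  have hVmem : ∀ v, v ∈ V ↔ ‖v - ‖v‖ • (u : E3)‖ < δ * ‖v‖ := fun v =>
    ⟨fun h => h.2, fun h => ⟨hypParam_mem v, h⟩⟩
  have hVm : MeasurableSet V :=
    continuous_hypParam.measurable (measurableSet_visualCone u δ)
  set A : Set E3 := {v | v ∈ V ∧ 0 < ‖v‖ ∧ ‖v‖ < 2}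
  have hAo : IsOpen A := by
    have : A = {v : E3 | ‖v - ‖v‖ • (u : E3)‖ < δ * ‖v‖} ∩ ({v | 0 < ‖v‖} ∩ {v | ‖v‖ < 2}) := by
      ext v
      simp only [A, mem_ofPred_eq, hVmem, mem_inter_iff]
    have h1 : IsOpen {v : E3 | ‖v - ‖v‖ • (u : E3)‖ < δ * ‖v‖} :=
      isOpen_lt (by fun_prop) (by fun_prop)
    rw [this]
    exact h1.inter
      ((isOpen_lt continuous_const continuous_norm).inter
        (isOpen_lt continuous_norm continuous_const))
  have hAne : A.Nonempty := ⟨u, (hVmem _).2 (by simp [hδ]), by simp, by simp⟩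
  have hApos : volume A ≠ 0 := (hAo.measure_pos volume hAne).ne'
  obtain ⟨n, hn⟩ := ENNReal.exists_nat_mul_gt hApos hne
  rw [hypVolume_apply (measurableSet_visualCone u δ), ← lintegral_indicator hVm] at hn
  set s : ℝ := 3 * (n + 1) with hs
  have hspos : 0 < s := by positivity
  rw [lintegral_eq_smul_lintegral_comp_smul hspos] at hn
  refine absurd hn (not_lt.2 ?_)
  have hlow : ENNReal.ofReal (1 / (3 * s)) * volume A ≤
      ∫⁻ v, V.indicator (fun v => ENNReal.ofReal (1 / Real.sqrt (1 + ‖v‖ ^ 2))) (s • v) := by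
    rw [← setLIntegral_const, ← lintegral_indicator hAo.measurableSet]
    refine lintegral_mono fun v => ?_
    by_cases hv : v ∈ A
    · have hsv : s • v ∈ V := by
        have e : s • v - (s * ‖v‖) • (u : E3) = s • (v - ‖v‖ • (u : E3)) := by
          rw [smul_sub, smul_smul]
        rw [hVmem, norm_smul, Real.norm_of_nonneg hspos.le, e, norm_smul,
          Real.norm_of_nonneg hspos.le, mul_left_comm]
        exact mul_lt_mul_of_pos_left ((hVmem v).1 hv.1) hspos
      rw [indicator_of_mem hv, indicator_of_mem hsv]
      apply ENNReal.ofReal_le_ofReal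
      apply one_div_le_one_div_of_le (by positivity)
      rw [Real.sqrt_le_left (by positivity), norm_smul, Real.norm_of_nonneg hspos.le]
      have h1 : s * ‖v‖ ≤ s * 2 := by gcongr; exact hv.2.2.le
      have h2 : 0 ≤ s * ‖v‖ := by positivity
      have h3 : (3 : ℝ) ≤ s := by rw [hs]; linarith [(Nat.cast_nonneg n : (0 : ℝ) ≤ n)]
      nlinarith
    · rw [indicator_of_notMem hv]
      exact zero_le
  refine le_trans ?_ (mul_le_mul_right hlow _)
  rw [← mul_assoc, ← ENNReal.ofReal_mul (by positivity)]
  refine mul_le_mul_left ?_ _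
  rw [← ENNReal.ofReal_natCast]
  apply ENNReal.ofReal_le_ofReal
  have : s ^ 3 * (1 / (3 * s)) = s ^ 2 / 3 := by field_simp
  rw [this, hs]
  nlinarith [(Nat.cast_nonneg n : (0 : ℝ) ≤ n)]

lemma neg_lorentz_nullVec_le {x : Mink} (hx : x ∈ H3) (q : S2) :
    -lorentz x (nullVec q) ≤ 2 * x.1 := by
  rw [neg_lorentz_nullVec]
  have h1 := neg_le_of_abs_le (abs_real_inner_le_norm x.2 (q : E3))
  rw [norm_coe_S2, mul_one] at h1
  linarith [norm_snd_lt_of_mem_H3 hx]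

/-- The exponential of the Busemann function at a boundary point away from the cone is comparable to
the time coordinate on the cone. -/
lemma le_neg_lorentz_nullVec {u q : S2} {δ : ℝ} (hδ : 0 < δ) (hδ1 : δ ≤ 1)
    (hq : 2 * δ ≤ dist u q) {x : Mink} (hx : x ∈ visualCone u δ) :
    δ ^ 2 / 2 * x.1 ≤ -lorentz x (nullVec q) := by
  obtain ⟨hxH, hxu⟩ := hx
  rw [neg_lorentz_nullVec]
  have hn := norm_snd_lt_of_mem_H3 hxH
  have hv : 0 < ‖x.2‖ := by
    have : 0 < δ * ‖x.2‖ := (norm_nonneg _).trans_lt hxu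
    exact pos_of_mul_pos_right this hδ.le
  have h1 : δ * ‖x.2‖ ≤ ‖x.2 - ‖x.2‖ • (q : E3)‖ := by
    have h2 : ‖‖x.2‖ • (u : E3) - ‖x.2‖ • (q : E3)‖ = ‖x.2‖ * dist u q := by
      rw [← smul_sub, norm_smul, norm_norm, Subtype.dist_eq, dist_eq_norm]
    have h3 := norm_sub_le_norm_sub_add_norm_sub (‖x.2‖ • (u : E3)) x.2 (‖x.2‖ • (q : E3))
    rw [h2, norm_sub_rev (‖x.2‖ • (u : E3)) x.2] at h3
    nlinarith
  have h4 : ‖x.2 - ‖x.2‖ • (q : E3)‖ ^ 2 = 2 * ‖x.2‖ ^ 2 - 2 * ‖x.2‖ * inner ℝ x.2 (q : E3) := by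
    rw [norm_sub_sq_real, inner_smul_right, norm_smul, norm_norm, norm_coe_S2]
    ring
  have h5 : (δ * ‖x.2‖) ^ 2 ≤ ‖x.2 - ‖x.2‖ • (q : E3)‖ ^ 2 := by gcongr
  have h6 : inner ℝ x.2 (q : E3) ≤ ‖x.2‖ * (1 - δ ^ 2 / 2) := by
    rw [h4] at h5
    have : ‖x.2‖ * inner ℝ x.2 (q : E3) ≤ ‖x.2‖ * (‖x.2‖ * (1 - δ ^ 2 / 2)) := by linarith
    exact le_of_mul_le_mul_left this hv
  have h7 : 0 ≤ (x.1 - ‖x.2‖) * (1 - δ ^ 2 / 2) := mul_nonneg (by linarith) (by nlinarith)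
  linarith

/-- The point at which the geodesic from the boundary point spanned by the null vector `N` through
`x` intersects the horosphere of the points `y` with `-⟨y, N⟩ = 1`. -/
def horoProj (N x : Mink) : Mink :=
  ((1 - ((-lorentz x N)⁻¹) ^ 2) / 2) • N + (-lorentz x N)⁻¹ • x

lemma map_horoProj {g : Mink ≃ₗ[ℝ] Mink} (hg : g ∈ isomH3) (N x : Mink) :
    g (horoProj N x) = horoProj (g N) (g x) := by
  simp only [horoProj, map_add, map_smul, lorentz_map hg]

lemma horoProj_mem {x : Mink} (hx : x ∈ H3) (q : S2) {c : ℝ} (hc : 0 < c) :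
    horoProj (c • nullVec q) x ∈ H3 := by
  have hb : 0 < -lorentz x (c • nullVec q) := by
    rw [lorentz_smul_right]
    nlinarith [neg_lorentz_nullVec_pos hx q]
  set N := c • nullVec q with hN
  set y := horoProj N x with hy
  have hNN : lorentz N N = 0 := by
    rw [hN, lorentz_smul_left, lorentz_smul_right, lorentz_nullVec_nullVec, dist_self]; simp
  set β := (-lorentz x N)⁻¹ with hβ
  have hβN : β * lorentz x N = -1 := by
    have : lorentz x N ≠ 0 := by linarith
    rw [hβ]
    field_simp
  have hyy : lorentz y y = -1 := by
    simp only [hy, horoProj, lorentz_add_left, lorentz_add_right, lorentz_smul_left,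
      lorentz_smul_right, hNN, lorentz_comm N x, hx.1, ← hβ]
    linear_combination (1 - β ^ 2) * hβN
  have hyN : lorentz y N = -1 := by
    simp only [hy, horoProj, lorentz_add_left, lorentz_smul_left, hNN, ← hβ]
    linear_combination hβN
  refine ⟨hyy, ?_⟩
  by_contra! hle
  have h1 : -lorentz y (nullVec q) ≤ 0 := by
    rw [neg_lorentz_nullVec]
    have h2 := neg_le_of_abs_le (abs_real_inner_le_norm y.2 (q : E3))
    rw [norm_coe_S2, mul_one] at h2
    simp only [lorentz, real_inner_self_eq_norm_sq] at hyy
    have h3 : ‖y.2‖ ≤ -y.1 := by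
      apply le_of_sq_le_sq _ (by linarith)
      nlinarith
    linarith
  rw [hN, lorentz_smul_right] at hyN
  nlinarith

lemma norm_eq_fst_of_mem_H3 {x : Mink} (hx : x ∈ H3) : ‖x‖ = x.1 := by
  rw [Prod.norm_def, Real.norm_of_nonneg hx.2.le, max_eq_left (norm_snd_lt_of_mem_H3 hx).le]

lemma norm_nullVec (q : S2) : ‖nullVec q‖ = 1 := by
  simp [nullVec, Prod.norm_def]

variable {H : parabolicPoints G → Set Mink} {t : parabolicPoints G → ℝ}

lemma IsThreshold.bddAbove (ht : IsThreshold H t) (hH : IsHoroballFamily G H) :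
    ∃ T, 1 ≤ T ∧ ∀ p, t p ≤ T := by
  have hf := (finite_setOf_le_of_sep (ht.sep hH) one_pos).image t
  obtain ⟨T, hT⟩ := hf.bddAbove
  refine ⟨max 1 T, le_max_left _ _, fun p => ?_⟩
  rcases le_total (t p) 1 with h | h
  · exact h.trans (le_max_left _ _)
  · exact (hT (mem_image_of_mem t h)).trans (le_max_right _ _)

/-- The parabolic points are dense in the sphere. Otherwise a visual cone of infinite volume would
meet only finitely many of its translates: projecting the points of the cone to the horosphere at
the nearest parabolic point is equivariant and takes values in a compact set. -/
theorem IsHoroballFamily.dense_parabolicPoints (hG : IsCuspedFiniteVolumeGroup G)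
    (hH : IsHoroballFamily G H) : DenseRange (fun p : parabolicPoints G => (p : S2)) := by
  obtain ⟨t, ht⟩ := hH.exists_isThreshold
  obtain ⟨T, hT1, hT⟩ := ht.bddAbove hH
  rw [DenseRange, Metric.dense_iff]
  by_contra! hcon
  obtain ⟨u, ε, hε, hempty⟩ := hcon
  set δ := min 1 (ε / 2) with hδ_def
  have hδ : 0 < δ := by positivity
  have hδ1 : δ ≤ 1 := min_le_left _ _
  have hfar : ∀ q : parabolicPoints G, 2 * δ ≤ dist u (q : S2) := fun q => by
    have h1 : (q : S2) ∉ ball u ε := fun h => by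
      have : (q : S2) ∈ ball u ε ∩ range fun p : parabolicPoints G => (p : S2) := ⟨h, q, rfl⟩
      rw [hempty] at this
      exact this
    rw [mem_ball, not_lt, dist_comm] at h1
    have : δ ≤ ε / 2 := min_le_right _ _
    linarith
  obtain ⟨p₀, hp₀⟩ := hG.cusped
  let N : parabolicPoints G → Mink := fun p => (t p)⁻¹ • nullVec p
  let f : parabolicPoints G → Mink → ℝ := fun p x => -lorentz x (N p)
  have hf : ∀ p x, f p x = (-lorentz x (nullVec p)) / t p := fun p x => by
    simp only [f, N, lorentz_smul_right]
    ring
  have hflow : ∀ p, ∀ x ∈ visualCone u δ, δ ^ 2 / 2 * x.1 ≤ f p x * t p := fun p x hx => by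
    rw [hf, div_mul_cancel₀ _ (ht.pos p).ne']
    exact le_neg_lorentz_nullVec hδ hδ1 (hfar p) hx
  set c : ℝ := δ ^ 2 / 4 * t ⟨p₀, hp₀⟩ with hc
  have hcpos : 0 < c := by have := ht.pos ⟨p₀, hp₀⟩; positivity
  -- Only large horoballs compete for being the nearest one.
  have hbig : ∀ q, ∀ x ∈ visualCone u δ, f q x ≤ f ⟨p₀, hp₀⟩ x → c ≤ t q := by
    intro q x hx hle
    have h1 := hflow q x hx
    have h2 : f ⟨p₀, hp₀⟩ x ≤ 2 * x.1 / t ⟨p₀, hp₀⟩ := by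
      rw [hf]
      exact div_le_div_of_nonneg_right (neg_lorentz_nullVec_le hx.1 _) (ht.pos _).le
    have h3 : f q x * t q ≤ 2 * x.1 / t ⟨p₀, hp₀⟩ * t q :=
      mul_le_mul_of_nonneg_right (hle.trans h2) (ht.pos q).le
    have h4 : δ ^ 2 / 2 * x.1 ≤ 2 * x.1 * t q / t ⟨p₀, hp₀⟩ := by
      calc _ ≤ _ := h1.trans h3
        _ = _ := by ring
    rw [le_div_iff₀ (ht.pos _)] at h4
    have hx1 := one_le_fst_of_mem_H3 hx.1
    have h5 : x.1 * (δ ^ 2 / 4 * t ⟨p₀, hp₀⟩) ≤ x.1 * t q := by linarith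
    exact le_of_mul_le_mul_left h5 (by linarith)
  have hmin : ∀ x ∈ visualCone u δ, ∃ q, ∀ q', f q x ≤ f q' x := by
    intro x hx
    have hfin : {q | f q x ≤ f ⟨p₀, hp₀⟩ x}.Finite :=
      (finite_setOf_le_of_sep (ht.sep hH) hcpos).subset fun q hq => hbig q x hx hq
    obtain ⟨q, hq, hqmin⟩ := Set.exists_min_image _ (fun q => f q x) hfin 
      ⟨⟨p₀, hp₀⟩, le_refl (f ⟨p₀, hp₀⟩ x)⟩
    refine ⟨q, fun q' => ?_⟩
    by_cases h : f q' x ≤ f ⟨p₀, hp₀⟩ x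
    · exact hqmin q' h
    · exact le_trans hq (not_le.1 h).le
  set B : ℝ := 2 * T / δ ^ 2 with hB
  set M : ℝ := (1 + B ^ 2) / 2 * c⁻¹ + B with hM
  have hK : ∀ q, ∀ x ∈ visualCone u δ, (∀ q', f q x ≤ f q' x) →
      horoProj (N q) x ∈ H3 ∩ closedBall 0 M := by
    intro q x hx hq
    have htq := ht.pos q
    refine ⟨horoProj_mem hx.1 _ (inv_pos.2 htq), ?_⟩
    have hx1 := one_le_fst_of_mem_H3 hx.1
    have hfl := hflow q x hx
    have hfpos : 0 < f q x := by
      have : 0 < f q x * t q := lt_of_lt_of_le (by positivity) hfl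
      exact pos_of_mul_pos_left this htq.le
    have hBx : (f q x)⁻¹ * x.1 ≤ B := by
      rw [inv_mul_le_iff₀ hfpos, hB, mul_div_assoc', le_div_iff₀ (by positivity)]
      have : f q x * t q ≤ f q x * T := by gcongr; exact hT q
      nlinarith
    have hinv : (f q x)⁻¹ ≤ B := by
      refine le_trans ?_ hBx
      exact le_mul_of_one_le_right (inv_pos.2 hfpos).le hx1
    have hinv0 : 0 < (f q x)⁻¹ := inv_pos.2 hfpos
    have hNn : ‖N q‖ ≤ c⁻¹ := by
      simp only [N]
      rw [norm_smul, norm_nullVec, mul_one, norm_inv, Real.norm_of_nonneg htq.le]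
      exact inv_anti₀ hcpos (hbig q x hx (hq _))
    rw [mem_closedBall_zero_iff]
    change ‖((1 - ((f q x)⁻¹) ^ 2) / 2) • N q + (f q x)⁻¹ • x‖ ≤ M
    refine (norm_add_le _ _).trans ?_
    rw [norm_smul _ (N q), norm_smul _ x, norm_eq_fst_of_mem_H3 hx.1,
      Real.norm_of_nonneg hinv0.le, hM]
    refine add_le_add (mul_le_mul ?_ hNn (norm_nonneg _) (by positivity)) hBx
    rw [Real.norm_eq_abs, abs_le]
    have : ((f q x)⁻¹) ^ 2 ≤ B ^ 2 := by gcongr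
    constructor <;> nlinarith [sq_nonneg (f q x)⁻¹]
  have hfin := hG.properlyDiscontinuous (H3 ∩ closedBall 0 M) inter_subset_left
    (isCompact_H3_inter_closedBall M)
  refine (hG.hypVolume_lt_top (measurableSet_visualCone u δ) hfin ?_).ne (hypVolume_visualCone u hδ)
  intro g hg x hx hgx
  have hgi := hG.isometric hg
  obtain ⟨q, hq⟩ := hmin x hx
  obtain ⟨q', hq'⟩ := ht.map_smul_nullVec hH hG.isometric hg q
  have hmin' : ∀ s, f q' (g x) ≤ f s (g x) := by
    intro s
    obtain ⟨s', hs'⟩ := ht.map_smul_nullVec hH hG.isometric (G.inv_mem hg) s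
    have e1 : f q' (g x) = f q x := by
      simp only [f, N]
      rw [← hq', lorentz_map hgi]
    have e2 : f s (g x) = f s' x := by
      have e3 : g (g⁻¹ (N s)) = N s := g.apply_symm_apply _
      have e4 : g⁻¹ (N s) = N s' := hs'
      change -lorentz (g x) (N s) = -lorentz x (N s')
      rw [← e3, lorentz_map hgi, e4]
    rw [e1, e2]
    exact hq s'
  refine ⟨hg, g (horoProj (N q) x), mem_image_of_mem _ (hK q x hx hq), ?_⟩
  have := hK q' (g x) hgx hmin'
  rw [map_horoProj hgi]
  simp only [N] at this ⊢
  rwa [hq']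

end

/-! ### The family of parabolic points -/

section

variable {G : Subgroup (Mink ≃ₗ[ℝ] Mink)}

/-- The radii are at most the thresholds, for which the inequality was shown. -/
theorem IsHoroballFamily.isSeparatedFamily {H : parabolicPoints G → Set Mink}
    (hG : IsCuspedFiniteVolumeGroup G) (hH : IsHoroballFamily G H) :
    IsSeparatedFamily (fun p : parabolicPoints G => (p : S2)) (fun p => radius (H p)) := by
  obtain ⟨t, ht⟩ := hH.exists_isThreshold
  refine ⟨fun p => radius_pos _, ht.radius_le_one, fun p q hpq => ?_,
    hH.dense_parabolicPoints hG⟩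
  refine le_trans ?_ (ht.sep hH p q hpq)
  gcongr
  · exact (radius_pos _).le
  · exact (ht.pos p).le
  · exact ht.radius_le p
  · exact ht.radius_le q

end

end CuspedHyperbolic

end

theorem proposition6p5
    (G : Subgroup (Mink ≃ₗ[ℝ] Mink)) (hG : IsCuspedFiniteVolumeGroup G)
    (H : parabolicPoints G → Set Mink) (hH : IsHoroballFamily G H) :
    ∃ l₀ : ℝ, 0 < l₀ ∧ l₀ ≤ 1 ∧ ∀ l : ℝ, 0 < l → l ≤ l₀ →
      (∀ p : parabolicPoints G, ∃ γ : Set S2,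
        IsEssentialCircle
          (Metric.ball (p : S2) (3 * l * radius (H p) / 4) \
            Metric.ball (p : S2) (l * radius (H p) / 4)) γ ∧
        ∀ p' : parabolicPoints G, p' ≠ p → radius (H p') ≤ radius (H p) →
          γ ∩ Metric.ball (p' : S2) (3 * l * radius (H p') / 4) = ∅) ∧
      (∃ (S : Set S2) (C : Set (Set S2)), IsSierpinskiCurve S C ∧
        stratum H l ⊆ S ∧ S ⊆ stratum H (l / 4) ∧
        ∀ γ ∈ C, ∃ p : parabolicPoints G,
          γ ⊆ Metric.ball (p : S2) (3 * l * radius (H p) / 4)) := by 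
  refine ⟨1 / 1000, by norm_num, by norm_num, fun l hl hl1 => ?_⟩
  have h := hH.isSeparatedFamily hG
  refine ⟨fun p => ?_, h.exists_isSierpinskiCurve hl hl1⟩
  obtain ⟨e, he⟩ := h.exists_isGoodDisk hl hl1 p
  exact ⟨diskBoundary e, he.essential, fun p' hp' hr =>
    disjoint_iff_inter_eq_empty.1 (he.disjoint p' hp' hr)⟩
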